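/- Let $G$ be the solvable Lie group with underlying manifold $\mathbb{R}^6$, coordinates $(t,x,y_1,y_2,z_1,z_2)$ and group law $$(t,x,y_1,y_2,z_1,z_2)*(t',x',y_1',y_2',z_1',z_2')=\left(t+t',\,x+x',\,e^{t}y_1'+xe^{t}z_1'+y_1,\,e^{-t}y_2'+xe^{-t}z_2'+y_2,\,e^{t}z_1'+z_1,\,e^{-t}z_2'+z_2\right).$$ Let $B\in SL(2,\mathbb{Z})$, $a_0\in\mathbb{R}\setminus\{0\}$ and $P\in GL(2,\mathbb{R})$ satisfy $PBP^{-1}=\operatorname{diag}(e^{a_0},e^{-a_0})$, let $\Gamma=\{(t,x,y,z): t\in a_0\mathbb{Z},\ x\in\mathbb{Z},\ y,z\in P\mathbb{Z}^2\}$ (with $y=(y_1,y_2)$, $z=(z_1,z_2)$) be the corresponding lattice in $G$, and let $X=\Gamma\backslash G$ be the associated compact solvmanifold. Consider the left-invariant coframe $$e^1=dt,\quad e^2=dx,\quad e^3=e^{-t}(dy_1-x\,dz_1),\quad e^4=e^{t}(dy_2-x\,dz_2),\quad e^5=e^{-t}dz_1,\quad e^6=e^{t}dz_2,$$ which descends to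 $X$. Let $J$ be the almost-complex structure on $X$ for which $\Phi^1=e^1+ie^2$, $\Phi^2=e^3+ie^4$, $\Phi^3=e^5+ie^6$ is a global coframe of $(1,0)$-forms, and endow $X$ with the $J$-Hermitian metric $g=\sum_{j=1}^6 e^j\otimes e^j$, with fundamental form $\omega=e^1\wedge e^2+e^3\wedge e^4+e^5\wedge e^6$. Let $\overline\partial:A^{p,q}(X)\to A^{p,q+1}(X)$ be the $(p,q+1)$-component of the exterior derivative on smooth complex-valued $(p,q)$-forms, let $\overline\partial^*$ be its formal adjoint with respect to the $L^2$ product defined by $g$, let $\Delta_{\overline\partial}=\overline\partial\,\overline\partial^*+\overline\partial^*\overline\partial$, and let $h^{p,q}_{\overline\partial}=\dim_{\mathbb{C}}\ker\left(\Delta_{\overline\partial}|_{A^{p,q}(X)}\right)$. Then $$h^{1,0}_{\overline\partial}=1,\qquad h^{2,0}_{\overline\partial}=1,\qquad h^{3,0}_{\overline\partial}=1.$$ -/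

import Mathlib

open scoped ContDiff ComplexConjugate

noncomputable section

namespace Solvmanifold

/-! ### The solvable Lie group `G`, in the global coordinates `(t, x, y₁, y₂, z₁, z₂)` -/

/-- The underlying manifold `ℝ⁶` of `G`; the coordinates `0, …, 5` are `t, x, y₁, y₂, z₁, z₂`. -/
abbrev E : Type := Fin 6 → ℝ

/-- The point of `G` with given coordinates, as a matrix. -/
def toMatrix (g : E) : Matrix (Fin 6) (Fin 6) ℝ :=
  !![Real.exp (g 0), 0, g 1 * Real.exp (g 0), 0, 0, g 2;
     0, Real.exp (-g 0), 0, g 1 * Real.exp (-g 0), 0, g 3;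
     0, 0, Real.exp (g 0), 0, 0, g 4;
     0, 0, 0, Real.exp (-g 0), 0, g 5;
     0, 0, 0, 0, 1, g 0;
     0, 0, 0, 0, 0, 1]

/-- Left translation `h ↦ g * h` of the group `G`. -/
def leftMul (g h : E) : E :=
  ![g 0 + h 0,
    g 1 + h 1,
    h 2 * Real.exp (g 0) + g 1 * h 4 * Real.exp (g 0) + g 2,
    h 3 * Real.exp (-g 0) + g 1 * h 5 * Real.exp (-g 0) + g 3,
    h 4 * Real.exp (g 0) + g 4,
    h 5 * Real.exp (-g 0) + g 5]

/-- The group law is matrix multiplication. -/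
theorem toMatrix_leftMul (g h : E) : toMatrix (leftMul g h) = toMatrix g * toMatrix h := by
  ext i j
  fin_cases i <;> fin_cases j <;>
    simp [toMatrix, leftMul, Matrix.mul_apply, Fin.sum_univ_succ, Real.exp_add] <;> ring

/-- The left-invariant frame `e₁, …, e₆`. -/
def frame (p : E) : Fin 6 → E :=
  ![![1, 0, 0, 0, 0, 0],
    ![0, 1, 0, 0, 0, 0],
    ![0, 0, Real.exp (p 0), 0, 0, 0],
    ![0, 0, 0, Real.exp (-p 0), 0, 0],
    ![0, 0, p 1 * Real.exp (p 0), 0, Real.exp (p 0), 0],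
    ![0, 0, 0, p 1 * Real.exp (-p 0), 0, Real.exp (-p 0)]]

/-- The coordinate differentials `dt, dx, dy₁, dy₂, dz₁, dz₂`. -/
def dcoord (i : Fin 6) : E →L[ℝ] ℝ := ContinuousLinearMap.proj i

/-- The left-invariant coframe `e¹, …, e⁶`. -/
def coframe (p : E) : Fin 6 → (E →L[ℝ] ℝ) :=
  ![dcoord 0,
    dcoord 1,
    Real.exp (-p 0) • dcoord 2 - (p 1 * Real.exp (-p 0)) • dcoord 4,
    Real.exp (p 0) • dcoord 3 - (p 1 * Real.exp (p 0)) • dcoord 5,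
    Real.exp (-p 0) • dcoord 4,
    Real.exp (p 0) • dcoord 5]

theorem coframe_frame (p : E) (i j : Fin 6) :
    coframe p i (frame p j) = if i = j then 1 else 0 := by
  fin_cases i <;> fin_cases j <;>
    simp [coframe, frame, dcoord, Real.exp_neg] <;> field_simp <;> simp

/-! ### The almost-complex structure -/

/-- The coframe `Φ¹ = e¹ + i e²`, `Φ² = e³ + i e⁴`, `Φ³ = e⁵ + i e⁶`. -/
def Phi (p : E) : Fin 3 → (E →L[ℝ] ℂ) :=
  ![Complex.ofRealCLM ∘L coframe p 0 + Complex.I • (Complex.ofRealCLM ∘L coframe p 1),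
    Complex.ofRealCLM ∘L coframe p 2 + Complex.I • (Complex.ofRealCLM ∘L coframe p 3),
    Complex.ofRealCLM ∘L coframe p 4 + Complex.I • (Complex.ofRealCLM ∘L coframe p 5)]

/-- The almost-complex structure `J` on `T_p G`: `J e₁ = e₂`, `J e₃ = e₄`, `J e₅ = e₆`,
`J² = -1`. -/
def J (p : E) : E →L[ℝ] E :=
  (coframe p 0).smulRight (frame p 1) - (coframe p 1).smulRight (frame p 0)
    + (coframe p 2).smulRight (frame p 3) - (coframe p 3).smulRight (frame p 2)
    + (coframe p 4).smulRight (frame p 5) - (coframe p 5).smulRight (frame p 4)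

theorem J_J (p : E) (v : E) : J p (J p v) = -v := by
  funext i
  fin_cases i <;>
    simp [J, coframe, frame, dcoord, Real.exp_neg] <;> field_simp <;> ring

/-- `Φ¹, Φ², Φ³` are forms of type `(1,0)` for `J`. -/
theorem Phi_J (p : E) (j : Fin 3) (v : E) : Phi p j (J p v) = Complex.I * Phi p j v := by
  fin_cases j <;>
    simp [Phi, J, coframe_frame, mul_add, ← mul_assoc, add_comm]

/-! ### The lattice -/

/-- The linear map `(s₀, …, s₅) ↦ (a₀ s₀, s₁, P (s₂, s₃), P (s₄, s₅))`. -/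
def latticeMap (a₀ : ℝ) (P : Matrix (Fin 2) (Fin 2) ℝ) (s : E) : E :=
  ![a₀ * s 0, s 1,
    P 0 0 * s 2 + P 0 1 * s 3, P 1 0 * s 2 + P 1 1 * s 3,
    P 0 0 * s 4 + P 0 1 * s 5, P 1 0 * s 4 + P 1 1 * s 5]

/-- The lattice `Γ = (a₀ℤ × ℤ) ⋉ L` of `G`, where `L = {(P m, P n) : m, n ∈ ℤ²}`. -/
def lattice (a₀ : ℝ) (P : Matrix (Fin 2) (Fin 2) ℝ) : Set E :=
  {g | ∃ m : Fin 6 → ℤ, g = latticeMap a₀ P (fun i => (m i : ℝ))}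

/-- A fundamental domain for the action of `Γ` on `G` by left translations. -/
def fundDomain (a₀ : ℝ) (P : Matrix (Fin 2) (Fin 2) ℝ) : Set E :=
  latticeMap a₀ P '' {s | ∀ i, 0 ≤ s i ∧ s i < 1}

/-! ### Complex-valued forms and their types -/

/-- Complex-valued `k`-forms on `G` (with no regularity). -/
abbrev Form (k : ℕ) : Type := E → E [⋀^Fin k]→L[ℝ] ℂ

/-- For `S ⊆ Fin k`, the map
`(v₁, …, v_k) ↦ α(w₁, …, w_k)`, where `w_j = (v_j - i A v_j) / 2` for `j ∈ S`,
`w_j = (v_j + i A v_j) / 2` for `j ∉ S`, and `α` is extended complex-multilinearly. It is written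
out by expanding the product: `T` is the set of the slots in which `± i A v_j` is taken. -/
def mixedPart {k : ℕ} (A : E →L[ℝ] E) (S : Finset (Fin k)) (α : E [⋀^Fin k]→L[ℝ] ℂ) :
    ContinuousMultilinearMap ℝ (fun _ : Fin k => E) ℂ :=
  ((1 / 2 : ℂ) ^ k) • ∑ T : Finset (Fin k),
    (∏ j ∈ T, if j ∈ S then -Complex.I else Complex.I) •
      α.toContinuousMultilinearMap.compContinuousLinearMap
        (fun j => if j ∈ T then A else ContinuousLinearMap.id ℝ E)

theorem mixedPart_apply {k : ℕ} (A : E →L[ℝ] E) (S : Finset (Fin k)) (α : E [⋀^Fin k]→L[ℝ] ℂ)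
    (v : Fin k → E) :
    mixedPart A S α v = (1 / 2 : ℂ) ^ k * ∑ T : Finset (Fin k),
      (∏ j ∈ T, if j ∈ S then -Complex.I else Complex.I) *
        α (fun j => if j ∈ T then A (v j) else v j) := by
  simp only [mixedPart, smul_apply, sum_apply,
    smul_eq_mul, ContinuousMultilinearMap.compContinuousLinearMap_apply]
  congr 1
  refine Finset.sum_congr rfl fun T _ => ?_
  congr 1
  change α _ = α _
  congr 1
  funext j
  split_ifs <;> rfl

theorem sum_mixedPart_eq_zero {k : ℕ} (p : ℕ) (A : E →L[ℝ] E) (α : E [⋀^Fin k]→L[ℝ] ℂ)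
    (v : Fin k → E) (i j : Fin k) (hv : v i = v j) (hij : i ≠ j) :
    ∑ S ∈ Finset.powersetCard p (Finset.univ : Finset (Fin k)), mixedPart A S α v = 0 := by
  set σ : Equiv.Perm (Fin k) := Equiv.swap i j with hσ
  have hvσ : ∀ l, v (σ l) = v l := by
    intro l
    rcases eq_or_ne l i with rfl | h1
    · simp [hσ, hv]
    rcases eq_or_ne l j with rfl | h2
    · simp [hσ, hv]
    · simp [hσ, Equiv.swap_apply_of_ne_of_ne h1 h2]
  have key : ∀ S : Finset (Fin k),
      mixedPart A (S.map σ.toEmbedding) α v = - mixedPart A S α v := by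
    intro S
    rw [mixedPart_apply, mixedPart_apply, ← mul_neg, ← Finset.sum_neg_distrib]
    congr 1
    refine (Fintype.sum_equiv (Equiv.finsetCongr σ) _ _ fun T => ?_).symm
    have h1 : ∏ l ∈ (Equiv.finsetCongr σ) T,
        (if l ∈ S.map σ.toEmbedding then -Complex.I else Complex.I) =
        ∏ l ∈ T, if l ∈ S then -Complex.I else Complex.I := by
      rw [Equiv.finsetCongr_apply, Finset.prod_map]
      simp
    have h2 : (fun l => if l ∈ (Equiv.finsetCongr σ) T then A (v l) else v l) ∘ σ =
        fun l => if l ∈ T then A (v l) else v l := by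
      funext l
      simp [hvσ]
    rw [h1, ← h2, ← mul_neg]
    congr 1
    have := α.toAlternatingMap.map_swap
      (fun l => if l ∈ (Equiv.finsetCongr σ) T then A (v l) else v l) hij
    change α _ = - α _ at this
    rw [← hσ] at this
    rw [this, neg_neg]
  have hsum : ∑ S ∈ Finset.powersetCard p (Finset.univ : Finset (Fin k)), mixedPart A S α v =
      ∑ S ∈ Finset.powersetCard p (Finset.univ : Finset (Fin k)), - mixedPart A S α v := by
    refine (Finset.sum_equiv (Equiv.finsetCongr σ) ?_ ?_).symm
    · intro S
      simp [Finset.mem_powersetCard]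
    · intro S _
      rw [Equiv.finsetCongr_apply, key]
  rw [Finset.sum_neg_distrib] at hsum
  exact self_eq_neg.mp hsum

/-- The component of type `(p, k - p)` of a complex-valued alternating `k`-form `α` on a real
vector space with complex structure `A`: exactly `p` of the arguments are replaced by their
`(1,0)`-parts, and the others by their `(0,1)`-parts. -/
def typeProj {k : ℕ} (A : E →L[ℝ] E) (p : ℕ) (α : E [⋀^Fin k]→L[ℝ] ℂ) : E [⋀^Fin k]→L[ℝ] ℂ where
  toContinuousMultilinearMap :=
    ∑ S ∈ Finset.powersetCard p (Finset.univ : Finset (Fin k)), mixedPart A S α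
  map_eq_zero_of_eq' v i j hv hij := by
    simpa using sum_mixedPart_eq_zero p A α v i j hv hij

theorem typeProj_apply {k : ℕ} (A : E →L[ℝ] E) (p : ℕ) (α : E [⋀^Fin k]→L[ℝ] ℂ)
    (v : Fin k → E) :
    typeProj A p α v =
      ∑ S ∈ Finset.powersetCard p (Finset.univ : Finset (Fin k)), mixedPart A S α v := by
  change (∑ S ∈ Finset.powersetCard p (Finset.univ : Finset (Fin k)), mixedPart A S α) v = _
  simp

theorem typeProj_add {k : ℕ} (A : E →L[ℝ] E) (p : ℕ) (α β : E [⋀^Fin k]→L[ℝ] ℂ) :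
    typeProj A p (α + β) = typeProj A p α + typeProj A p β := by
  ext v
  simp only [typeProj_apply, mixedPart_apply, ContinuousAlternatingMap.add_apply, mul_add,
    Finset.sum_add_distrib]

theorem typeProj_smul {k : ℕ} (A : E →L[ℝ] E) (p : ℕ) (c : ℂ) (α : E [⋀^Fin k]→L[ℝ] ℂ) :
    typeProj A p (c • α) = c • typeProj A p α := by
  ext v
  simp only [typeProj_apply, mixedPart_apply, ContinuousAlternatingMap.smul_apply, smul_eq_mul,
    Finset.mul_sum]
  refine Finset.sum_congr rfl fun S _ => Finset.sum_congr rfl fun T _ => ?_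
  ring

/-- The space `A^{p,q}(X)` of smooth complex-valued forms of type `(p,q)` on `X = Γ \ G`: the
smooth `Γ`-invariant forms on `G` of type `(p,q)`. -/
def A (a₀ : ℝ) (P : Matrix (Fin 2) (Fin 2) ℝ) (p q : ℕ) : Submodule ℂ (Form (p + q)) where
  carrier := {ψ | ContDiff ℝ ∞ ψ ∧
    (∀ g ∈ lattice a₀ P, ∀ x,
      (ψ (leftMul g x)).compContinuousLinearMap (fderiv ℝ (leftMul g) x) = ψ x) ∧
    ∀ x, typeProj (J x) p (ψ x) = ψ x}
  zero_mem' := by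
    refine ⟨contDiff_const, fun g _ x => ?_, fun x => ?_⟩
    · ext v
      simp
    · ext v
      simp [typeProj_apply, mixedPart_apply]
  add_mem' := by
    rintro ψ φ ⟨h1, h2, h3⟩ ⟨h1', h2', h3'⟩
    refine ⟨h1.add h1', fun g hg x => ?_, fun x => ?_⟩
    · rw [Pi.add_apply, Pi.add_apply, ← h2 g hg x, ← h2' g hg x]
      rfl
    · rw [Pi.add_apply, typeProj_add, h3, h3']
  smul_mem' := by
    rintro c ψ ⟨h1, h2, h3⟩
    refine ⟨contDiff_const.smul h1, fun g hg x => ?_, fun x => ?_⟩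
    · rw [Pi.smul_apply, Pi.smul_apply, ← h2 g hg x]
      rfl
    · rw [Pi.smul_apply, typeProj_smul, h3]

/-- The operator `∂̄` on forms of type `(p,q)`: the component of type `(p,q+1)` of `d`. -/
def dbar (p q : ℕ) (ψ : Form (p + q)) : Form (p + (q + 1)) :=
  fun x => typeProj (J x) p (extDeriv ψ x)

/-! ### The metric, the formal adjoint of `∂̄` and the Laplacian -/

/-- The Hermitian product at `x` of complex-valued `k`-forms, induced by the metric
`∑ eⁱ ⊗ eⁱ` with fundamental form `e¹² + e³⁴ + e⁵⁶`. -/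
def formInner {k : ℕ} (x : E) (α β : E [⋀^Fin k]→L[ℝ] ℂ) : ℂ :=
  (1 / (k.factorial : ℂ)) * ∑ I : Fin k → Fin 6,
    α (fun j => frame x (I j)) * conj (β (fun j => frame x (I j)))

/-- The `L²` Hermitian product of `Γ`-invariant forms over `X`. The Riemannian volume form
`e¹²³⁴⁵⁶` is `dt dx dy₁ dy₂ dz₁ dz₂`. -/
def L2 (a₀ : ℝ) (P : Matrix (Fin 2) (Fin 2) ℝ) {k : ℕ} (α β : Form k) : ℂ :=
  ∫ x in fundDomain a₀ P, formInner x (α x) (β x)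

/-- `β = ∂̄* η` where `∂̄*` is the formal adjoint of `∂̄ : A^{p,q}(X) → A^{p,q+1}(X)`. -/
def IsDbarStar (a₀ : ℝ) (P : Matrix (Fin 2) (Fin 2) ℝ) (p q : ℕ)
    (η : Form (p + (q + 1))) (β : Form (p + q)) : Prop :=
  β ∈ A a₀ P p q ∧ ∀ φ ∈ A a₀ P p q, L2 a₀ P (dbar p q φ) η = L2 a₀ P φ β

/-- `ρ = (∂̄ ∂̄* + ∂̄* ∂̄) ψ` for `ψ ∈ A^{p,q}(X)`; on `A^{p,0}(X)` the operator `∂̄*` vanishes,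
as there are no forms of type `(p,-1)`. -/
def IsLaplacian (a₀ : ℝ) (P : Matrix (Fin 2) (Fin 2) ℝ) (p : ℕ) :
    (q : ℕ) → Form (p + q) → Form (p + q) → Prop
  | 0, ψ, ρ => IsDbarStar a₀ P p 0 (dbar p 0 ψ) ρ
  | q + 1, ψ, ρ => ∃ (α : Form (p + q)) (β : Form (p + (q + 1))),
      IsDbarStar a₀ P p q ψ α ∧ IsDbarStar a₀ P p (q + 1) (dbar p (q + 1) ψ) β ∧
        ρ = dbar p q α + β

theorem dbar_add {p q : ℕ} {ψ φ : Form (p + q)} (hψ : ContDiff ℝ ∞ ψ) (hφ : ContDiff ℝ ∞ φ) :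
    dbar p q (ψ + φ) = dbar p q ψ + dbar p q φ := by
  funext x
  simp only [dbar, Pi.add_apply]
  rw [extDeriv_add (hψ.differentiable (by simp) x) (hφ.differentiable (by simp) x)]
  exact typeProj_add _ _ _ _

theorem dbar_smul {p q : ℕ} (c : ℂ) {ψ : Form (p + q)} (hψ : ContDiff ℝ ∞ ψ) :
    dbar p q (c • ψ) = c • dbar p q ψ := by
  funext x
  have h : extDeriv (c • ψ) x = c • extDeriv ψ x := by
    have hd : fderiv ℝ (c • ψ) x = c • fderiv ℝ ψ x :=
      fderiv_const_smul (hψ.differentiable (by simp) x) c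
    ext v
    simp only [extDeriv, hd, ContinuousAlternatingMap.smul_apply,
      ContinuousAlternatingMap.alternatizeUncurryFin_apply, Finset.smul_sum]
    refine Finset.sum_congr rfl fun i _ => ?_
    rw [smul_comm c]
    rfl
  simp only [dbar, Pi.smul_apply]
  rw [h]
  exact typeProj_smul _ _ _ _

theorem continuous_frame (i : Fin 6) : Continuous fun x => frame x i := by
  refine continuous_pi fun j => ?_
  fin_cases i <;> fin_cases j <;> simp [frame] <;> fun_prop

theorem continuous_J_apply {u : E → E} (hu : Continuous u) : Continuous fun x => J x (u x) := by
  have hc : ∀ i, Continuous fun x => coframe x i (u x) := by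
    intro i
    fin_cases i <;> simp [coframe, dcoord] <;> fun_prop
  have hf := continuous_frame
  simp only [J, add_apply, sub_apply,
    ContinuousLinearMap.smulRight_apply]
  exact (((((hc 0).smul (hf 1)).sub ((hc 1).smul (hf 0))).add ((hc 2).smul (hf 3))).sub
    ((hc 3).smul (hf 2))).add ((hc 4).smul (hf 5)) |>.sub ((hc 5).smul (hf 4))

/-- Weak continuity of a form: continuous coefficients in the frame. -/
def ContCoeff {k : ℕ} (α : Form k) : Prop :=
  ∀ I : Fin k → Fin 6, Continuous fun x => α x (fun j => frame x (I j))

theorem ContCoeff.of_continuous {k : ℕ} {α : Form k} (h : Continuous α) : ContCoeff α :=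
  fun I => h.eval (continuous_pi fun j => continuous_frame (I j))

theorem contCoeff_dbar {p q : ℕ} {ψ : Form (p + q)} (hψ : ContDiff ℝ ∞ ψ) :
    ContCoeff (dbar p q ψ) := by
  intro I
  have hd : Continuous (extDeriv ψ) := by
    have h1 : Continuous (fderiv ℝ ψ) := hψ.continuous_fderiv (by simp)
    exact (ContinuousAlternatingMap.alternatizeUncurryFinCLM ℝ E ℂ).continuous.comp h1
  simp only [dbar, typeProj_apply, mixedPart_apply]
  refine continuous_finsetSum _ fun S _ => continuous_const.mul <|
    continuous_finsetSum _ fun T _ => continuous_const.mul ?_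
  refine hd.eval (continuous_pi fun j => ?_)
  by_cases hj : j ∈ T
  · simpa [hj] using continuous_J_apply (continuous_frame (I j))
  · simpa [hj] using continuous_frame (I j)

theorem integrable_inner (a₀ : ℝ) (P : Matrix (Fin 2) (Fin 2) ℝ) {k : ℕ} {α β : Form k}
    (hα : ContCoeff α) (hβ : ContCoeff β) :
    MeasureTheory.IntegrableOn (fun x => formInner x (α x) (β x)) (fundDomain a₀ P) := by
  have hc : Continuous fun x => formInner x (α x) (β x) := by
    refine continuous_const.mul <| continuous_finsetSum _ fun I _ => (hα I).mul ?_
    exact Complex.continuous_conj.comp (hβ I)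
  have hm : Continuous (latticeMap a₀ P) := by
    refine continuous_pi fun j => ?_
    fin_cases j <;> simp [latticeMap] <;> fun_prop
  have hK : IsCompact (latticeMap a₀ P '' Set.Icc 0 1) := isCompact_Icc.image hm
  refine (hc.continuousOn.integrableOn_compact hK).mono_set ?_
  exact Set.image_mono fun s hs => ⟨fun i => (hs i).1, fun i => (hs i).2.le⟩

theorem L2_add_right (a₀ : ℝ) (P : Matrix (Fin 2) (Fin 2) ℝ) {k : ℕ} {α β γ : Form k}
    (hα : ContCoeff α) (hβ : ContCoeff β) (hγ : ContCoeff γ) :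
    L2 a₀ P α (β + γ) = L2 a₀ P α β + L2 a₀ P α γ := by
  rw [L2, L2, L2,
    ← MeasureTheory.integral_add (integrable_inner a₀ P hα hβ) (integrable_inner a₀ P hα hγ)]
  congr 1
  funext x
  simp [formInner, mul_add, Finset.sum_add_distrib]

theorem L2_smul_right (a₀ : ℝ) (P : Matrix (Fin 2) (Fin 2) ℝ) {k : ℕ} (c : ℂ) (α β : Form k) :
    L2 a₀ P α (c • β) = conj c * L2 a₀ P α β := by
  rw [L2, L2, ← MeasureTheory.integral_const_mul]
  congr 1
  funext x
  simp only [formInner, Pi.smul_apply, ContinuousAlternatingMap.smul_apply, smul_eq_mul, map_mul,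
    Finset.mul_sum]
  refine Finset.sum_congr rfl fun I _ => ?_
  ring

section

variable {a₀ : ℝ} {P : Matrix (Fin 2) (Fin 2) ℝ} {p q : ℕ}

theorem contCoeff_of_mem {ψ : Form (p + q)} (h : ψ ∈ A a₀ P p q) : ContCoeff ψ :=
  ContCoeff.of_continuous h.1.continuous

theorem IsDbarStar.add {η η' : Form (p + (q + 1))} {β β' : Form (p + q)}
    (hη : ContCoeff η) (hη' : ContCoeff η')
    (h : IsDbarStar a₀ P p q η β) (h' : IsDbarStar a₀ P p q η' β') :
    IsDbarStar a₀ P p q (η + η') (β + β') := by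
  refine ⟨add_mem h.1 h'.1, fun φ hφ => ?_⟩
  rw [L2_add_right a₀ P (contCoeff_dbar hφ.1) hη hη',
    L2_add_right a₀ P (contCoeff_of_mem hφ) (contCoeff_of_mem h.1) (contCoeff_of_mem h'.1),
    h.2 φ hφ, h'.2 φ hφ]

theorem IsDbarStar.smul (c : ℂ) {η : Form (p + (q + 1))} {β : Form (p + q)}
    (h : IsDbarStar a₀ P p q η β) : IsDbarStar a₀ P p q (c • η) (c • β) := by
  refine ⟨Submodule.smul_mem _ c h.1, fun φ hφ => ?_⟩
  rw [L2_smul_right, L2_smul_right, h.2 φ hφ]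

theorem IsLaplacian.add {ψ ψ' ρ ρ' : Form (p + q)}
    (hψ : ψ ∈ A a₀ P p q) (hψ' : ψ' ∈ A a₀ P p q)
    (h : IsLaplacian a₀ P p q ψ ρ) (h' : IsLaplacian a₀ P p q ψ' ρ') :
    IsLaplacian a₀ P p q (ψ + ψ') (ρ + ρ') := by
  cases q with
  | zero =>
    simp only [IsLaplacian] at h h' ⊢
    rw [dbar_add hψ.1 hψ'.1]
    exact h.add (contCoeff_dbar hψ.1) (contCoeff_dbar hψ'.1) h'
  | succ q =>
    obtain ⟨α, β, h1, h2, h3⟩ := h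
    obtain ⟨α', β', h1', h2', h3'⟩ := h'
    refine ⟨α + α', β + β', h1.add (contCoeff_of_mem hψ) (contCoeff_of_mem hψ') h1', ?_, ?_⟩
    · rw [dbar_add hψ.1 hψ'.1]
      exact h2.add (contCoeff_dbar hψ.1) (contCoeff_dbar hψ'.1) h2'
    · rw [dbar_add h1.1.1 h1'.1.1, h3, h3']
      abel

theorem IsLaplacian.smul (c : ℂ) {ψ ρ : Form (p + q)} (hψ : ψ ∈ A a₀ P p q)
    (h : IsLaplacian a₀ P p q ψ ρ) : IsLaplacian a₀ P p q (c • ψ) (c • ρ) := by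
  cases q with
  | zero =>
    simp only [IsLaplacian] at h ⊢
    rw [dbar_smul c hψ.1]
    exact h.smul c
  | succ q =>
    obtain ⟨α, β, h1, h2, h3⟩ := h
    refine ⟨c • α, c • β, h1.smul c, ?_, ?_⟩
    · rw [dbar_smul c hψ.1]
      exact h2.smul c
    · rw [dbar_smul c h1.1.1, h3, smul_add]

theorem IsDbarStar.zero : IsDbarStar a₀ P p q 0 0 :=
  ⟨zero_mem _, fun φ _ => by simp [L2, formInner]⟩

theorem dbar_zero : dbar p q 0 = 0 := by
  have h := dbar_add (p := p) (q := q) (ψ := 0) (φ := 0) contDiff_const contDiff_const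
  rw [add_zero] at h
  exact left_eq_add.mp h

theorem IsLaplacian.zero : IsLaplacian a₀ P p q 0 0 := by
  cases q with
  | zero =>
    simp only [IsLaplacian]
    rw [dbar_zero]
    exact IsDbarStar.zero
  | succ q =>
    refine ⟨0, 0, IsDbarStar.zero, ?_, ?_⟩
    · rw [dbar_zero]
      exact IsDbarStar.zero
    · rw [dbar_zero, add_zero]

end

/-- The space of `∂̄`-harmonic `(p,q)`-forms on `X`: the kernel of the Laplacian
`∂̄ ∂̄* + ∂̄* ∂̄` on `A^{p,q}(X)`. -/
def harmonic (a₀ : ℝ) (P : Matrix (Fin 2) (Fin 2) ℝ) (p q : ℕ) : Submodule ℂ (Form (p + q)) where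
  carrier := {ψ | ψ ∈ A a₀ P p q ∧ IsLaplacian a₀ P p q ψ 0}
  zero_mem' := ⟨zero_mem _, IsLaplacian.zero⟩
  add_mem' := by
    rintro ψ φ ⟨h1, h2⟩ ⟨h1', h2'⟩
    exact ⟨add_mem h1 h1', by simpa using h2.add h1 h1' h2'⟩
  smul_mem' := by
    rintro c ψ ⟨h1, h2⟩
    exact ⟨Submodule.smul_mem _ c h1, by
      have h := h2.smul c h1
      have h0 : c • (0 : Form (p + q)) = 0 := by
        funext x
        ext v
        simp
      rwa [h0] at h⟩

/-- The Hodge number `h^{p,q}_∂̄` of `X`. -/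
def hodgeNumber (a₀ : ℝ) (P : Matrix (Fin 2) (Fin 2) ℝ) (p q : ℕ) : ℕ :=
  Module.finrank ℂ (harmonic a₀ P p q)

end Solvmanifold

end

noncomputable section

namespace Solvmanifold

/-! ### The left-invariant trivialization of the tangent bundle -/

/-! On forms of type (p,0) the Laplacian is ∂̄*∂̄, and pairing it with the form itself shows that
its kernel consists of the ∂̄-closed forms (`mem_harmonic_iff`). Everything then rests on solving
∂̄ψ = 0.

Let W_1 = e_1 + i e_2, W_2 = e_3 + i e_4, W_3 = e_5 + i e_6 be the antiholomorphic invariant fields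
(numbered 0, 1, 2 in `Fin 3`). The coefficients of ψ on e_1, e_3, e_5 are Γ-invariant functions, and
∂̄ψ = 0 makes each W_j-derivative of a coefficient a linear combination of coefficients with
constant factors (`dbarFun_coeff_hol`). The constants come from brackets of the W_j with the fields
of type (1,0) (`antiBracketLinear_hol`). For p = 1 the system is W_1 f_3 = i f_2, W_2 f_1 = -f_2,
W_3 f_1 = -f_3, all other W_j f_k being 0.

The analytic input is a Liouville argument (`fderiv_eq_zero_of_dbarFun_const`). The leaf through a
point tangent to a pair e, Je is an affine plane on which both fields are constant, hence a copy of
ℂ on which W_j is ∂_s + i∂_r. Invariant functions are bounded, because translates of a relatively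
compact domain cover G (`exists_leftMul_eq`), and a bounded function on ℂ whose ∂̄-derivative is
constant is itself constant. So W_j f = c forces c = 0, and W_j f = 0 for all j forces f to be
constant.

The system is triangular: solved in the right order, every coefficient becomes a constant, and an
equation whose right side is a nonzero multiple of that constant kills it. One coefficient survives
for each p, that of Φ^1, Φ^1∧Φ^3 and Φ^1∧Φ^2∧Φ^3 respectively. These forms are indeed ∂̄-closed
(`PhiWedge_mem_harmonic`), so each space is a line (`hodgeNumber_eq_one`). -/

/-- The differential of the left translation by `g`: the linear map taking the standard basis to
the left-invariant frame at `g`. -/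
def frameMap (g : E) : E →L[ℝ] E :=
  ∑ i, (dcoord i).smulRight (frame g i)

theorem frameMap_apply (g w : E) : frameMap g w =
    ![w 0, w 1,
      Real.exp (g 0) * w 2 + g 1 * Real.exp (g 0) * w 4,
      Real.exp (-g 0) * w 3 + g 1 * Real.exp (-g 0) * w 5,
      Real.exp (g 0) * w 4, Real.exp (-g 0) * w 5] := by
  funext i
  fin_cases i <;> simp [frameMap, Fin.sum_univ_succ, dcoord, frame] <;> ring

theorem frameMap_single (g : E) (i : Fin 6) : frameMap g (Pi.single i 1) = frame g i := by
  simp [frameMap, dcoord, Pi.single_apply]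

theorem frameMap_surjective (g : E) : Function.Surjective (frameMap g) := by
  intro v
  refine ⟨fun i => coframe g i v, ?_⟩
  rw [frameMap_apply]
  funext i
  fin_cases i <;> simp [coframe, dcoord, Real.exp_neg] <;> field_simp <;> ring

theorem leftMul_eq (g h : E) : leftMul g h = g + frameMap g h := by
  rw [frameMap_apply]
  funext i
  fin_cases i <;> simp [leftMul] <;> ring

theorem hasFDerivAt_leftMul (g x : E) : HasFDerivAt (leftMul g) (frameMap g) x := by
  have h : leftMul g = fun y => g + frameMap g y := funext (leftMul_eq g)
  rw [h]
  exact (frameMap g).hasFDerivAt.const_add g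

/-- Left invariance of the frame: left translation by g is affine with linear part `frameMap g`.
This is why coefficients of Γ-invariant forms are Γ-invariant functions. -/
theorem frameMap_leftMul (g x w : E) :
    frameMap (leftMul g x) w = frameMap g (frameMap x w) := by
  simp only [frameMap_apply]
  funext i
  fin_cases i <;> simp [leftMul, Real.exp_add] <;> ring

theorem J_zero_apply (w : E) : J 0 w = ![-w 1, w 0, -w 3, w 2, -w 5, w 4] := by
  funext i
  fin_cases i <;> simp [J, coframe, dcoord, frame]

theorem J_frameMap (g w : E) : J g (frameMap g w) = frameMap g (J 0 w) := by
  simp only [frameMap_apply, J_zero_apply]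
  funext i
  fin_cases i <;> simp [J, coframe, dcoord, frame, Real.exp_neg] <;> field_simp <;> ring

/-- The covariant derivative, in the left-invariant frame, of the flat connection of `ℝ⁶`. -/
def conn (u w : E) : E :=
  ![0, 0, u 0 * w 2 + u 1 * w 4, -(u 0 * w 3) + u 1 * w 5, u 0 * w 4, -(u 0 * w 5)]

/-- The Lie bracket of the Lie algebra of `G`, in the left-invariant frame. -/
def bracket (u w : E) : E := conn u w - conn w u

theorem contDiff_frameMap_apply (w : E) : ContDiff ℝ ∞ fun x => frameMap x w := by
  simp only [frameMap_apply]
  refine contDiff_pi.2 fun i => ?_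
  fin_cases i <;> simp <;> fun_prop

/-- The frame depends on the point only through e^t, e^{-t} and x, so its derivatives along itself
have constant coefficients in the frame. The exterior derivative thereby reduces to constant
structure terms. -/
theorem fderiv_frameMap_apply (x u w : E) :
    fderiv ℝ (fun y => frameMap y w) x (frameMap x u) = frameMap x (conn u w) := by
  have hd : DifferentiableAt ℝ (fun y => frameMap y w) x :=
    (contDiff_frameMap_apply w).differentiable (by simp) x
  have h0 : HasFDerivAt (fun y : E => y 0) (dcoord 0) x := (dcoord 0).hasFDerivAt
  have h1 : HasFDerivAt (fun y : E => y 1) (dcoord 1) x := (dcoord 1).hasFDerivAt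
  have key : ∀ i, fderiv ℝ (fun y => frameMap y w) x (frameMap x u) i =
      fderiv ℝ (fun y => frameMap y w i) x (frameMap x u) := by
    intro i
    rw [(hasFDerivAt_pi'.1 hd.hasFDerivAt i).fderiv]
    rfl
  funext i
  rw [key]
  simp only [frameMap_apply]
  fin_cases i
  · simp [conn]
  · simp [conn]
  · simp only [Fin.reduceFinMk, Matrix.cons_val]
    rw [((h0.exp.mul_const (w 2)).fun_add ((h1.fun_mul h0.exp).mul_const (w 4))).fderiv]
    simp [conn, dcoord]
    ring
  · simp only [Fin.reduceFinMk, Matrix.cons_val]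
    rw [((h0.fun_neg.exp.mul_const (w 3)).fun_add ((h1.fun_mul h0.fun_neg.exp).mul_const (w 5))).fderiv]
    simp [conn, dcoord]
    ring
  · simp only [Fin.reduceFinMk, Matrix.cons_val]
    rw [(h0.exp.mul_const (w 4)).fderiv]
    simp [conn, dcoord]
    ring
  · simp only [Fin.reduceFinMk, Matrix.cons_val]
    rw [(h0.fun_neg.exp.mul_const (w 5)).fderiv]
    simp [conn, dcoord]
    ring

/-! ### Algebra of types -/

section Types

variable {k : ℕ} (A : E →L[ℝ] E)

/-- Apply `A` in the slots belonging to `T`. -/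
def applyOn (T : Finset (Fin k)) (v : Fin k → E) : Fin k → E :=
  fun j => if j ∈ T then A (v j) else v j

/-- Expansion of the slotwise product of the operators `1 + c j • A`, `j ∈ s`. -/
def slotSum (c : Fin k → ℂ) (s : Finset (Fin k)) (h : (Fin k → E) → ℂ) (v : Fin k → E) : ℂ :=
  ∑ T ∈ s.powerset, (∏ j ∈ T, c j) * h (applyOn A T v)

/-- `h` is complex linear in each slot, for the complex structure `A`. -/
def IsTypeTop (h : (Fin k → E) → ℂ) : Prop :=
  ∀ l v, h (Function.update v l (A (v l))) = Complex.I * h v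

variable {A}

theorem applyOn_empty (v : Fin k → E) : applyOn A ∅ v = v := by
  funext j
  simp [applyOn]

theorem applyOn_insert {T : Finset (Fin k)} {l : Fin k} (hl : l ∉ T) (v : Fin k → E) :
    applyOn A (insert l T) v = applyOn A T (Function.update v l (A (v l))) := by
  funext j
  rcases eq_or_ne j l with rfl | hj
  · simp [applyOn, hl]
  · simp [applyOn, hj]

theorem applyOn_update {T : Finset (Fin k)} {l : Fin k} (hl : l ∉ T) (v : Fin k → E) (u : E) :
    applyOn A T (Function.update v l u) = Function.update (applyOn A T v) l u := by
  funext j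
  rcases eq_or_ne j l with rfl | hj
  · simp [applyOn, hl]
  · simp [applyOn, hj]

theorem slotSum_insert (c : Fin k → ℂ) {s : Finset (Fin k)} {l : Fin k} (hl : l ∉ s)
    (h : (Fin k → E) → ℂ) (v : Fin k → E) :
    slotSum A c (insert l s) h v =
      slotSum A c s h v + c l * slotSum A c s h (Function.update v l (A (v l))) := by
  rw [slotSum, Finset.sum_powerset_insert hl, slotSum, slotSum, Finset.mul_sum]
  congr 1
  refine Finset.sum_congr rfl fun T hT => ?_
  have hlT : l ∉ T := fun h => hl (Finset.mem_powerset.1 hT h)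
  rw [Finset.prod_insert hlT, applyOn_insert hlT, mul_assoc]

theorem slotSum_congr (c : Fin k → ℂ) (s : Finset (Fin k)) {h h' : (Fin k → E) → ℂ}
    (hh : ∀ v, h v = h' v) (v : Fin k → E) : slotSum A c s h v = slotSum A c s h' v := by
  rw [funext hh]

theorem slotSum_add (c : Fin k → ℂ) (s : Finset (Fin k)) (h h' : (Fin k → E) → ℂ)
    (v : Fin k → E) :
    slotSum A c s (fun v => h v + h' v) v = slotSum A c s h v + slotSum A c s h' v := by
  simp [slotSum, mul_add, Finset.sum_add_distrib]

theorem slotSum_mul (c : Fin k → ℂ) (s : Finset (Fin k)) (a : ℂ) (h : (Fin k → E) → ℂ)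
    (v : Fin k → E) :
    slotSum A c s (fun v => a * h v) v = a * slotSum A c s h v := by
  simp only [slotSum, Finset.mul_sum]
  exact Finset.sum_congr rfl fun T _ => by ring

theorem slotSum_sub (c : Fin k → ℂ) (s : Finset (Fin k)) (h h' : (Fin k → E) → ℂ)
    (v : Fin k → E) :
    slotSum A c s (fun v => h v - h' v) v = slotSum A c s h v - slotSum A c s h' v := by
  simp [slotSum, mul_sub, Finset.sum_sub_distrib]

theorem slotSum_sum {ι : Type*} (c : Fin k → ℂ) (s : Finset (Fin k)) (t : Finset ι)
    (h : ι → (Fin k → E) → ℂ) (v : Fin k → E) :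
    slotSum A c s (fun v => ∑ i ∈ t, h i v) v = ∑ i ∈ t, slotSum A c s (h i) v := by
  simp only [slotSum, Finset.mul_sum]
  exact Finset.sum_comm

theorem slotSum_shift (c : Fin k → ℂ) {s : Finset (Fin k)} {l : Fin k} (hl : l ∉ s)
    (h : (Fin k → E) → ℂ) (v : Fin k → E) :
    slotSum A c s h (Function.update v l (A (v l))) =
      slotSum A c s (fun v => h (Function.update v l (A (v l)))) v := by
  refine Finset.sum_congr rfl fun T hT => ?_
  have hlT : l ∉ T := fun h => hl (Finset.mem_powerset.1 hT h)
  rw [applyOn_update hlT]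
  simp [applyOn, hlT]

/-- On functions that are eigenvectors of the slot operators, the slot sum is a multiple of the
identity. -/
theorem slotSum_eigen (c : Fin k → ℂ) (s : Finset (Fin k)) (h : (Fin k → E) → ℂ)
    (hh : ∀ l ∈ s, ∀ v, c l * h (Function.update v l (A (v l))) = h v) (v : Fin k → E) :
    slotSum A c s h v = 2 ^ s.card * h v := by
  induction s using Finset.induction_on generalizing v with
  | empty => simp [slotSum, applyOn_empty]
  | insert l s hl ih =>
    have ih' := ih fun j hj => hh j (Finset.mem_insert_of_mem hj)
    rw [slotSum_insert c hl, ih', ih', Finset.card_insert_of_notMem hl, mul_left_comm,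
      hh l (Finset.mem_insert_self l s), pow_succ]
    ring

/-- The factor belonging to slot l is 1 + cA with c² = -1 and A² = -1, hence cA(1 + cA) = 1 + cA.
Only compatibility of h with negation in that slot is needed. -/
theorem slotSum_equivariant (hA : ∀ v, A (A v) = -v) (c : Fin k → ℂ) {s : Finset (Fin k)}
    {l : Fin k} (hl : l ∈ s) (hc : c l * c l = -1) (h : (Fin k → E) → ℂ)
    (hh : ∀ (v : Fin k → E) u, h (Function.update v l (-u)) = -h (Function.update v l u))
    (v : Fin k → E) :
    c l * slotSum A c s h (Function.update v l (A (v l))) = slotSum A c s h v := by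
  obtain ⟨t, ht, rfl⟩ : ∃ t, l ∉ t ∧ s = insert l t :=
    ⟨s.erase l, Finset.notMem_erase l s, (Finset.insert_erase hl).symm⟩
  have hneg : slotSum A c t h (Function.update v l (-v l)) = -slotSum A c t h v := by
    rw [slotSum, slotSum, ← Finset.sum_neg_distrib]
    refine Finset.sum_congr rfl fun T hT => ?_
    have hlT : l ∉ T := fun h => ht (Finset.mem_powerset.1 hT h)
    rw [applyOn_update hlT, hh, ← applyOn_update hlT, Function.update_eq_self, mul_neg]
  rw [slotSum_insert c ht, slotSum_insert c ht]
  simp only [Function.update_self, Function.update_idem, hA, hneg]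
  linear_combination (-slotSum A c t h v) * hc

theorem IsTypeTop.applyOn {h : (Fin k → E) → ℂ} (hh : IsTypeTop A h) (T : Finset (Fin k))
    (v : Fin k → E) : h (applyOn A T v) = Complex.I ^ T.card * h v := by
  induction T using Finset.induction_on generalizing v with
  | empty => simp [applyOn_empty]
  | insert l T hl ih =>
    rw [applyOn_insert hl, ih, hh, Finset.card_insert_of_notMem hl, pow_succ, mul_assoc]

theorem mixedPart_eq_slotSum (S : Finset (Fin k)) (α : E [⋀^Fin k]→L[ℝ] ℂ) (v : Fin k → E) :
    mixedPart A S α v = (1 / 2 : ℂ) ^ k *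
      slotSum A (fun j => if j ∈ S then -Complex.I else Complex.I) Finset.univ α v := by
  rw [mixedPart_apply, slotSum, Finset.powerset_univ]
  rfl

theorem map_update_neg' (α : E [⋀^Fin k]→L[ℝ] ℂ) (v : Fin k → E) (l : Fin k) (u : E) :
    α (Function.update v l (-u)) = -α (Function.update v l u) := by
  have h := α.map_update_smul v l (-1) u
  simpa using h

theorem mixedPart_update (hA : ∀ v, A (A v) = -v) (S : Finset (Fin k))
    (α : E [⋀^Fin k]→L[ℝ] ℂ) (v : Fin k → E) (l : Fin k) :
    mixedPart A S α (Function.update v l (A (v l))) =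
      (if l ∈ S then Complex.I else -Complex.I) * mixedPart A S α v := by
  have h := slotSum_equivariant hA (fun j => if j ∈ S then -Complex.I else Complex.I)
    (Finset.mem_univ l) (by by_cases hl : l ∈ S <;> simp [hl]) α
    (fun v u => map_update_neg' α v l u) v
  rw [mixedPart_eq_slotSum, mixedPart_eq_slotSum, ← h]
  by_cases hl : l ∈ S
  · simp only [hl, if_true]
    linear_combination ((1 / 2 : ℂ) ^ k * slotSum A _ Finset.univ α _) * Complex.I_mul_I
  · simp only [hl, if_false]
    linear_combination ((1 / 2 : ℂ) ^ k * slotSum A _ Finset.univ α _) * Complex.I_mul_I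

theorem typeProj_top_apply (α : E [⋀^Fin k]→L[ℝ] ℂ) (v : Fin k → E) :
    typeProj A k α v = mixedPart A Finset.univ α v := by
  have h : Finset.powersetCard k (Finset.univ : Finset (Fin k)) = {Finset.univ} := by
    have h := Finset.powersetCard_self (Finset.univ : Finset (Fin k))
    rwa [Finset.card_fin] at h
  rw [typeProj_apply, h, Finset.sum_singleton]

/-- The forms of type `(k,0)` are the complex multilinear ones. -/
theorem typeProj_top_eq_self_iff (hA : ∀ v, A (A v) = -v) (α : E [⋀^Fin k]→L[ℝ] ℂ) :
    typeProj A k α = α ↔ IsTypeTop A α := by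
  constructor
  · intro h l v
    have h' : ∀ v, α v = mixedPart A Finset.univ α v := fun v => by
      conv_lhs => rw [← h]
      exact typeProj_top_apply α v
    rw [h', mixedPart_update hA, ← h']
    simp
  · intro h
    ext v
    rw [typeProj_top_apply, mixedPart_eq_slotSum, slotSum_eigen]
    · simp
    · intro l _ v
      rw [h l v]
      simp [← mul_assoc]

/-- Transpositions carry the single antiholomorphic slot to slot 0, so that it is enough to study
that position. -/
theorem mixedPart_map_swap (S : Finset (Fin k)) (α : E [⋀^Fin k]→L[ℝ] ℂ) (v : Fin k → E)
    {i j : Fin k} (hij : i ≠ j) :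
    mixedPart A (S.map (Equiv.swap i j).toEmbedding) α v =
      -mixedPart A S α (v ∘ Equiv.swap i j) := by
  set σ : Equiv.Perm (Fin k) := Equiv.swap i j with hσ
  rw [mixedPart_apply, mixedPart_apply, ← mul_neg, ← Finset.sum_neg_distrib]
  congr 1
  refine (Fintype.sum_equiv (Equiv.finsetCongr σ) _ _ fun T => ?_).symm
  have h1 : ∏ l ∈ (Equiv.finsetCongr σ) T,
      (if l ∈ S.map σ.toEmbedding then -Complex.I else Complex.I) =
      ∏ l ∈ T, if l ∈ S then -Complex.I else Complex.I := by
    rw [Equiv.finsetCongr_apply, Finset.prod_map]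
    simp
  have h2 : (fun l => if l ∈ (Equiv.finsetCongr σ) T then A (v l) else v l) ∘ σ =
      fun l => if l ∈ T then A ((v ∘ σ) l) else (v ∘ σ) l := by
    funext l
    simp
  rw [h1, ← h2, ← mul_neg]
  congr 1
  have := α.toAlternatingMap.map_swap
    (fun l => if l ∈ (Equiv.finsetCongr σ) T then A (v l) else v l) hij
  change α _ = - α _ at this
  rw [← hσ] at this
  rw [this, neg_neg]

theorem typeProj_codim_one_apply {p : ℕ} (β : E [⋀^Fin (p + 1)]→L[ℝ] ℂ) (v : Fin (p + 1) → E) :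
    typeProj A p β v = ∑ l, mixedPart A (Finset.univ.erase l) β v := by
  rw [typeProj_apply]
  symm
  refine Finset.sum_nbij (fun l => Finset.univ.erase l) ?_ ?_ ?_ fun _ _ => rfl
  · intro l _
    simp [Finset.mem_powersetCard, Finset.card_erase_of_mem]
  · intro l _ m _ h
    by_contra hlm
    have h2 : l ∈ (Finset.univ : Finset (Fin (p + 1))).erase m := by simp [hlm]
    rw [← show Finset.univ.erase l = Finset.univ.erase m from h] at h2
    simp at h2
  · intro S hS
    have hS' := Finset.mem_powersetCard_univ.1 (Finset.mem_coe.1 hS)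
    have hc : Sᶜ.card = 1 := by simp [Finset.card_compl, hS']
    obtain ⟨l, hl⟩ := Finset.card_eq_one.1 hc
    refine ⟨l, by simp, ?_⟩
    ext m
    have hm : m ∈ Sᶜ ↔ m = l := by simp [hl]
    rw [Finset.mem_compl] at hm
    simp only [Finset.mem_erase, Finset.mem_univ, and_true]
    tauto

/-- Vanishing of the component of type `(p,1)` of a `(p+1)`-form, read off from the evaluation on
one antiholomorphic and `p` holomorphic vectors. -/
theorem typeProj_codim_one_eq_zero_iff {p : ℕ} (hA : ∀ v, A (A v) = -v)
    (β : E [⋀^Fin (p + 1)]→L[ℝ] ℂ) :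
    typeProj A p β = 0 ↔ ∀ v, slotSum A (fun _ => -Complex.I) (Finset.univ.erase 0)
      (fun v => β v + Complex.I * β (Function.update v 0 (A (v 0)))) v = 0 := by
  have hm : ∀ v, mixedPart A (Finset.univ.erase 0) β v = (1 / 2 : ℂ) ^ (p + 1) *
      slotSum A (fun _ => -Complex.I) (Finset.univ.erase 0)
        (fun v => β v + Complex.I * β (Function.update v 0 (A (v 0)))) v := by
    intro v
    rw [mixedPart_eq_slotSum, slotSum_add, slotSum_mul,
      ← slotSum_shift (fun _ => -Complex.I) (Finset.notMem_erase 0 _) β]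
    conv_lhs => rw [← Finset.insert_erase (Finset.mem_univ (0 : Fin (p + 1)))]
    rw [slotSum_insert _ (Finset.notMem_erase 0 _)]
    have hs : ∀ v', slotSum A (fun j => if j ∈ (insert (0 : Fin (p + 1))
        (Finset.univ.erase 0)).erase 0 then -Complex.I else Complex.I) (Finset.univ.erase 0) β v' =
        slotSum A (fun _ => -Complex.I) (Finset.univ.erase 0) β v' := by
      intro v'
      refine Finset.sum_congr rfl fun T hT => ?_
      congr 1
      refine Finset.prod_congr rfl fun j hj => ?_
      have := Finset.mem_powerset.1 hT hj
      simp [Finset.ne_of_mem_erase this]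
    simp only [Finset.insert_erase (Finset.mem_univ (0 : Fin (p + 1)))] at hs ⊢
    rw [hs, hs]
    simp
  have hiff : (∀ v, slotSum A (fun _ => -Complex.I) (Finset.univ.erase 0)
      (fun v => β v + Complex.I * β (Function.update v 0 (A (v 0)))) v = 0) ↔
      ∀ v, mixedPart A (Finset.univ.erase 0) β v = 0 := by
    refine forall_congr' fun v => ?_
    rw [hm]
    simp
  rw [hiff]
  constructor
  · intro h v
    have h1 : ∑ l, mixedPart A (Finset.univ.erase l) β v = 0 := by
      rw [← typeProj_codim_one_apply, h]
      rfl
    have h2 : ∑ l, mixedPart A (Finset.univ.erase l) β (Function.update v 0 (A (v 0))) = 0 := by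
      rw [← typeProj_codim_one_apply, h]
      rfl
    -- Applying A in slot 0 multiplies the term l = 0 by -i and every other term by i. Together with
    -- the unmodified equation this isolates the term l = 0.
    simp only [mixedPart_update hA] at h2
    rw [Fin.sum_univ_succ] at h1 h2
    simp only [Finset.mem_erase, ne_eq, not_true_eq_false, Finset.mem_univ, and_true, if_false,
      (Fin.succ_ne_zero _).symm, not_false_eq_true, if_true, ← Finset.mul_sum] at h2
    have h3 : Complex.I * mixedPart A (Finset.univ.erase 0) β v = 0 := by
      linear_combination (1 / 2) * Complex.I * h1 - (1 / 2) * h2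
    simpa using h3
  · intro h
    ext v
    rw [typeProj_codim_one_apply]
    refine Finset.sum_eq_zero fun l _ => ?_
    rcases eq_or_ne l 0 with rfl | hl
    · exact h v
    · have he : (Finset.univ.erase 0).map (Equiv.swap 0 l).toEmbedding = Finset.univ.erase l := by
        rw [Finset.map_erase]
        simp
      rw [← he, mixedPart_map_swap _ _ _ hl.symm, h, neg_zero]

end Types

/-! ### The operator `∂̄` on forms of type `(p,0)` -/

section Dbar

variable {p : ℕ}

/-- Alternatization gives the term of v m the sign (-1)^(m+1), and moving u from the front to
position m costs (-1)^m; the product is always -1. -/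
theorem extDeriv_cons (ψ : Form p) (x u : E) (v : Fin p → E) :
    extDeriv ψ x (Matrix.vecCons u v) =
      fderiv ℝ ψ x u v - ∑ m, fderiv ℝ ψ x (v m) (Function.update v m u) := by
  rw [extDeriv, ContinuousAlternatingMap.alternatizeUncurryFin_apply, Fin.sum_univ_succ,
    sub_eq_add_neg, ← Finset.sum_neg_distrib]
  congr 1
  · simp
  · refine Finset.sum_congr rfl fun m _ => ?_
    cases p with
    | zero => exact m.elim0
    | succ n =>
      have h : m.succ.removeNth (Matrix.vecCons u v) = Matrix.vecCons u (m.removeNth v) := by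
        funext j
        refine Fin.cases ?_ (fun j => ?_) j <;> simp [Fin.removeNth]
      have h' := ContinuousAlternatingMap.neg_one_pow_smul_map_insertNth
        (fderiv ℝ ψ x (v m)) m u (m.removeNth v)
      rw [Fin.insertNth_removeNth] at h'
      rw [h, Matrix.cons_val_succ, ← h', smul_smul, Fin.val_succ, ← pow_add,
        show (m : ℕ) + 1 + m = 2 * m + 1 by ring, pow_succ, pow_mul]
      simp

/-- The coefficients of a form in the left-invariant frame. -/
def coeff (ψ : Form p) (w : Fin p → E) (x : E) : ℂ := ψ x fun m => frameMap x (w m)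

theorem differentiable_coeff {ψ : Form p} (hψ : ContDiff ℝ ∞ ψ) (w : Fin p → E) :
    Differentiable ℝ (coeff ψ w) := fun x =>
  ((hψ.differentiable (by simp) x).hasFDerivAt.continuousAlternatingMap_apply
    (g := fun m y => frameMap y (w m)) fun m =>
      ((contDiff_frameMap_apply (w m)).differentiable (by simp) x).hasFDerivAt).differentiableAt

theorem comp_update (L : E →L[ℝ] E) (w : Fin p → E) (m : Fin p) (z : E) :
    (fun j => L (Function.update w m z j)) = Function.update (fun j => L (w j)) m (L z) := by
  funext j
  rcases eq_or_ne j m with rfl | hj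
  · simp
  · simp [hj]

theorem coeff_update (ψ : Form p) (w : Fin p → E) (m : Fin p) (z x : E) :
    coeff ψ (Function.update w m z) x =
      ψ x (Function.update (fun j => frameMap x (w j)) m (frameMap x z)) := by
  rw [coeff, comp_update]

theorem isTypeTop_coeff {ψ : Form p} {x : E} (hJ : IsTypeTop (J x) (ψ x)) :
    IsTypeTop (J 0) fun w => coeff ψ w x := by
  intro l w
  simp only
  rw [coeff_update, ← J_frameMap]
  exact hJ l fun j => frameMap x (w j)

theorem fderiv_coeff {ψ : Form p} (hψ : ContDiff ℝ ∞ ψ) (x u : E) (w : Fin p → E) :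
    fderiv ℝ (coeff ψ w) x (frameMap x u) =
      fderiv ℝ ψ x (frameMap x u) (fun j => frameMap x (w j)) +
        ∑ m, coeff ψ (Function.update w m (conn u (w m))) x := by
  have h := fderiv_continuousAlternatingMap_apply_apply (f := ψ) (x := x)
    (g := fun m y => frameMap y (w m)) (hψ.differentiable (by simp) x)
    (fun m => (contDiff_frameMap_apply (w m)).differentiable (by simp) x) (frameMap x u)
  simp only [fderiv_frameMap_apply] at h
  simp only [coeff_update]
  exact h

theorem continuous_fderiv_coeff {ψ : Form p} (hψ : ContDiff ℝ ∞ ψ) (u : E) (w : Fin p → E) :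
    Continuous fun x => fderiv ℝ (coeff ψ w) x (frameMap x u) := by
  simp only [fderiv_coeff hψ]
  have hf : ∀ z, Continuous fun x => frameMap x z := fun z => (contDiff_frameMap_apply z).continuous
  refine Continuous.add ?_ (continuous_finsetSum _ fun m _ => (differentiable_coeff hψ _).continuous)
  exact ((hψ.continuous_fderiv (by simp)).clm_apply (hf u)).eval (continuous_pi fun j => hf (w j))

theorem IsTypeTop.update_J {h : (Fin p → E) → ℂ} {A : E →L[ℝ] E} (hh : IsTypeTop A h)
    (v : Fin p → E) (m : Fin p) (z : E) :
    h (Function.update v m (A z)) = Complex.I * h (Function.update v m z) := by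
  have := hh m (Function.update v m z)
  simpa using this

/-- A form of type (p,0) vanishes on u + iJu in any slot, at every point. Differentiating this
identity along z trades the derivative of ψ for the derivative of the frame. -/
theorem fderiv_update_of_isTypeTop {ψ : Form p} (hψ : ContDiff ℝ ∞ ψ)
    (hJ : ∀ x, IsTypeTop (J x) (ψ x)) (x u z : E) (v : Fin p → E) (m : Fin p) :
    fderiv ℝ ψ x (frameMap x z) (Function.update v m (frameMap x u)) +
      Complex.I * fderiv ℝ ψ x (frameMap x z) (Function.update v m (frameMap x (J 0 u))) =
    -(ψ x (Function.update v m (frameMap x (conn z u))) +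
      Complex.I * ψ x (Function.update v m (frameMap x (conn z (J 0 u))))) := by
  have hd : ∀ u : E, HasFDerivAt (fun y => ψ y (Function.update v m (frameMap y u)))
      (fderiv ℝ (fun y => ψ y (Function.update v m (frameMap y u))) x) x ∧
      fderiv ℝ (fun y => ψ y (Function.update v m (frameMap y u))) x (frameMap x z) =
      fderiv ℝ ψ x (frameMap x z) (Function.update v m (frameMap x u)) +
        ψ x (Function.update v m (frameMap x (conn z u))) := by
    intro u
    have hg : ∀ j, DifferentiableAt ℝ (fun y => Function.update v m (frameMap y u) j) x := by
      intro j
      rcases eq_or_ne j m with rfl | hj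
      · simpa using (contDiff_frameMap_apply u).differentiable (by simp) x
      · simp [hj]
    have hψ' : DifferentiableAt ℝ ψ x := hψ.differentiable (by simp) x
    constructor
    · exact (hψ'.hasFDerivAt.continuousAlternatingMap_apply
        fun j => (hg j).hasFDerivAt).differentiableAt.hasFDerivAt
    · have h := fderiv_continuousAlternatingMap_apply_apply (f := ψ) (x := x)
        (g := fun j y => Function.update v m (frameMap y u) j) hψ' hg (frameMap x z)
      refine h.trans ?_
      congr 1
      rw [Finset.sum_eq_single m]
      · simp [fderiv_frameMap_apply]
      · intro j _ hj
        simp only [ne_eq, hj, not_false_eq_true, Function.update_of_ne]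
        rw [(ψ x).map_coord_zero j]
        simp
      · simp
  have hz : (fun y => ψ y (Function.update v m (frameMap y u)) +
      Complex.I * ψ y (Function.update v m (frameMap y (J 0 u)))) = fun _ => 0 := by
    funext y
    rw [← J_frameMap, (hJ y).update_J, ← mul_assoc, Complex.I_mul_I]
    ring
  have h1 := (hd u).1.add ((hd (J 0 u)).1.const_mul Complex.I)
  have h2 : fderiv ℝ (fun y => ψ y (Function.update v m (frameMap y u)) +
      Complex.I * ψ y (Function.update v m (frameMap y (J 0 u)))) x (frameMap x z) = 0 := by
    rw [hz]
    simp
  have h3 := congrArg (fun l => l (frameMap x z)) h1.fderiv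
  change fderiv ℝ (fun y => ψ y (Function.update v m (frameMap y u)) +
      Complex.I * ψ y (Function.update v m (frameMap y (J 0 u)))) x (frameMap x z) = _ at h3
  rw [h2] at h3
  simp only [add_apply, smul_apply, smul_eq_mul,
    (hd _).2] at h3
  linear_combination -h3

/-- `2 [ū, w]` for an antiholomorphic and a real left-invariant field, up to terms of type
`(0,1)`. -/
def antiBracket (u w : E) : E := bracket u w + J 0 (bracket (J 0 u) w)

/-- This is Cartan's formula with an antiholomorphic first argument. As ψ vanishes on that argument,
only its derivative of the coefficient and its brackets with the w m survive. -/
theorem extDeriv_antiholomorphic {ψ : Form p} (hψ : ContDiff ℝ ∞ ψ)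
    (hJ : ∀ x, IsTypeTop (J x) (ψ x)) (x u : E) (w : Fin p → E) :
    extDeriv ψ x (Matrix.vecCons (frameMap x u) fun j => frameMap x (w j)) +
      Complex.I * extDeriv ψ x (Matrix.vecCons (frameMap x (J 0 u)) fun j => frameMap x (w j)) =
    fderiv ℝ (coeff ψ w) x (frameMap x u) + Complex.I * fderiv ℝ (coeff ψ w) x (frameMap x (J 0 u))
      - ∑ m, coeff ψ (Function.update w m (antiBracket u (w m))) x := by
  have hm : ∀ m, coeff ψ (Function.update w m (antiBracket u (w m))) x =
      coeff ψ (Function.update w m (conn u (w m))) x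
        + Complex.I * coeff ψ (Function.update w m (conn (J 0 u) (w m))) x
        + (fderiv ℝ ψ x (frameMap x (w m))
            (Function.update (fun j => frameMap x (w j)) m (frameMap x u)) +
          Complex.I * fderiv ℝ ψ x (frameMap x (w m))
            (Function.update (fun j => frameMap x (w j)) m (frameMap x (J 0 u)))) := by
    intro m
    rw [fderiv_update_of_isTypeTop hψ hJ]
    simp only [coeff_update, antiBracket, bracket, map_add, map_sub]
    rw [ContinuousAlternatingMap.map_update_add, ContinuousAlternatingMap.map_update_sub,
      ContinuousAlternatingMap.map_update_sub, ← J_frameMap, ← J_frameMap,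
      (hJ x).update_J, (hJ x).update_J]
    ring
  rw [extDeriv_cons, extDeriv_cons, fderiv_coeff hψ, fderiv_coeff hψ, Finset.sum_congr rfl
    fun m _ => hm m]
  simp only [Finset.sum_add_distrib, ← Finset.mul_sum]
  ring

/-- The complex linear part of `antiBracket u`. -/
def antiBracketLinear (u w : E) : E :=
  (1 / 2 : ℝ) • (antiBracket u w - J 0 (antiBracket u (J 0 w)))

theorem slotSum_frameMap (x : E) (c : Fin p → ℂ) (s : Finset (Fin p)) (h : (Fin p → E) → ℂ)
    (w : Fin p → E) :
    slotSum (J x) c s h (fun j => frameMap x (w j)) =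
      slotSum (J 0) c s (fun w => h fun j => frameMap x (w j)) w := by
  refine Finset.sum_congr rfl fun T _ => ?_
  congr 2
  funext j
  simp only [applyOn]
  split_ifs
  · exact J_frameMap x (w j)
  · rfl

theorem coeff_update_J {ψ : Form p} (hJ : ∀ x, IsTypeTop (J x) (ψ x)) (w : Fin p → E)
    (l : Fin p) :
    coeff ψ (Function.update w l (J 0 (w l))) = fun x => Complex.I * coeff ψ w x :=
  funext fun x => isTypeTop_coeff (hJ x) l w

/-- The `∂̄`-derivative of a form of type `(p,0)` in the left-invariant frame. -/
def dbarCoeff (ψ : Form p) (u : E) (w : Fin p → E) (x : E) : ℂ :=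
  fderiv ℝ (coeff ψ w) x (frameMap x u) + Complex.I * fderiv ℝ (coeff ψ w) x (frameMap x (J 0 u))
    - ∑ m, coeff ψ (Function.update w m (antiBracketLinear u (w m))) x

/-- Here the slots 1, …, p are projected to type (1,0), each factor being twice a projection. The
projection replaces `antiBracket` by its complex linear part and leaves the overall factor 2^p. -/
theorem slotSum_extDeriv {ψ : Form p} (hψ : ContDiff ℝ ∞ ψ)
    (hJ : ∀ x, IsTypeTop (J x) (ψ x)) (x : E) (w : Fin (p + 1) → E) :
    slotSum (J x) (fun _ => -Complex.I) (Finset.univ.erase 0)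
      (fun v => extDeriv ψ x v + Complex.I * extDeriv ψ x (Function.update v 0 (J x (v 0))))
      (fun j => frameMap x (w j)) = 2 ^ p * dbarCoeff ψ (w 0) (Fin.tail w) x := by
  have hII : ∀ z : ℂ, -Complex.I * (Complex.I * z) = z := fun z => by
    rw [← mul_assoc]
    simp
  have h1 : ∀ w : Fin (p + 1) → E,
      extDeriv ψ x (fun j => frameMap x (w j)) +
        Complex.I * extDeriv ψ x (Function.update (fun j => frameMap x (w j)) 0
          (J x (frameMap x (w 0)))) =
      (fderiv ℝ (coeff ψ (Fin.tail w)) x (frameMap x (w 0)) +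
        Complex.I * fderiv ℝ (coeff ψ (Fin.tail w)) x (frameMap x (J 0 (w 0))))
      - ∑ m, coeff ψ (Function.update (Fin.tail w) m (antiBracket (w 0) (Fin.tail w m))) x := by
    intro w
    rw [← extDeriv_antiholomorphic hψ hJ, J_frameMap]
    congr 2
    · funext j
      refine Fin.cases ?_ (fun j => ?_) j <;> simp [Fin.tail]
    · congr 1
      funext j
      refine Fin.cases ?_ (fun j => ?_) j <;> simp [Fin.tail]
  rw [slotSum_frameMap, slotSum_congr _ _ h1, slotSum_sub, slotSum_sum, dbarCoeff, mul_sub,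
    Finset.mul_sum]
  congr 1
  -- The derivative terms are already complex linear in the p remaining slots, so each factor is 2.
  · rw [slotSum_eigen]
    · simp
    · intro l hl v
      obtain ⟨m, rfl⟩ := Fin.exists_succ_eq.2 (Finset.ne_of_mem_erase hl)
      rw [Fin.tail_update_succ, show v m.succ = Fin.tail v m from rfl, coeff_update_J hJ,
        fderiv_const_mul (differentiable_coeff hψ _ x)]
      simp only [Function.update_of_ne (Fin.succ_ne_zero m).symm, smul_apply,
        smul_eq_mul]
      rw [← hII (fderiv ℝ (coeff ψ (Fin.tail v)) x (frameMap x (v 0)) + _)]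
      ring
  · refine Finset.sum_congr rfl fun m _ => ?_
    -- The m-th bracket term is complex linear in every slot except m. Slot m is split off: the
    -- others give 2^(p-1), and 1 - iJ in slot m gives twice `antiBracketLinear`.
    have hs : (Finset.univ : Finset (Fin (p + 1))).erase 0 =
        insert m.succ ((Finset.univ.erase 0).erase m.succ) :=
      (Finset.insert_erase (by simp)).symm
    have hp : p = ((Finset.univ.erase 0).erase m.succ : Finset (Fin (p + 1))).card + 1 := by
      rw [Finset.card_erase_add_one (by simp)]
      simp
    have he : ∀ l ∈ (Finset.univ.erase 0).erase m.succ, ∀ v : Fin (p + 1) → E,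
        -Complex.I * coeff ψ (Function.update (Fin.tail (Function.update v l (J 0 (v l)))) m
          (antiBracket (Function.update v l (J 0 (v l)) 0)
            (Fin.tail (Function.update v l (J 0 (v l))) m))) x =
        coeff ψ (Function.update (Fin.tail v) m (antiBracket (v 0) (Fin.tail v m))) x := by
      intro l hl v
      obtain ⟨n, rfl⟩ := Fin.exists_succ_eq.2
        (Finset.ne_of_mem_erase (Finset.mem_of_mem_erase hl))
      have hnm : n ≠ m := fun h => Finset.ne_of_mem_erase hl (congrArg Fin.succ h)
      rw [Fin.tail_update_succ, Function.update_of_ne (Fin.succ_ne_zero n).symm,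
        Function.update_of_ne hnm.symm, Function.update_comm hnm,
        (isTypeTop_coeff (hJ x)).update_J, hII,
        show Function.update (Function.update (Fin.tail v) m _) n (v n.succ) =
          Function.update (Fin.tail v) m (antiBracket (v 0) (Fin.tail v m)) from ?_]
      rw [Function.update_comm hnm.symm]
      congr 1
      exact Function.update_eq_self n (Fin.tail v)
    rw [hs, slotSum_insert _ (Finset.notMem_erase _ _), slotSum_eigen _ _ _ he,
      slotSum_eigen _ _ _ he, mul_left_comm, ← mul_add]
    rw [show (2 : ℂ) ^ p = 2 ^ ((Finset.univ.erase 0).erase m.succ : Finset (Fin (p + 1))).card * 2 by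
      rw [← pow_succ, ← hp], mul_assoc]
    congr 1
    rw [Fin.tail_update_succ, Function.update_of_ne (Fin.succ_ne_zero m).symm,
      Function.update_self, Function.update_idem, antiBracketLinear]
    simp only [coeff_update, map_smul, map_sub, ← J_frameMap]
    rw [ContinuousAlternatingMap.map_update_smul, ContinuousAlternatingMap.map_update_sub,
      (hJ x).update_J, Complex.real_smul]
    push_cast
    simp only [Fin.tail]
    ring

theorem dbar_eq_zero_iff {ψ : Form (p + 0)} (hψ : ContDiff ℝ ∞ ψ)
    (hJ : ∀ x, IsTypeTop (J x) (ψ x)) (x : E) :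
    dbar p 0 ψ x = 0 ↔ ∀ u w, dbarCoeff ψ u w x = 0 := by
  refine (typeProj_codim_one_eq_zero_iff (p := p) (J_J x) (extDeriv ψ x)).trans ?_
  constructor
  · intro h u w
    have h' := h fun j => frameMap x ((Fin.cons u w : Fin (p + 1) → E) j)
    rw [slotSum_extDeriv (p := p) hψ hJ] at h'
    simpa using h'
  · intro h v
    choose w hw using fun j => frameMap_surjective x (v j)
    rw [← funext hw, slotSum_extDeriv (p := p) hψ hJ, h, mul_zero]

end Dbar

/-! ### The fundamental domain and invariant functions -/

section Lattice

variable {B : Matrix.SpecialLinearGroup (Fin 2) ℤ} {a₀ : ℝ} {P : Matrix (Fin 2) (Fin 2) ℝ}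

theorem diagonal_exp_mul (s t : ℝ) :
    Matrix.diagonal ![Real.exp s, Real.exp (-s)] * Matrix.diagonal ![Real.exp t, Real.exp (-t)] =
      Matrix.diagonal ![Real.exp (s + t), Real.exp (-(s + t))] := by
  rw [Matrix.diagonal_mul_diagonal]
  congr 1
  funext i
  fin_cases i <;> simp [← Real.exp_add, add_comm]

theorem mul_zpow_eq (hP : IsUnit P.det)
    (hB : P * (B : Matrix (Fin 2) (Fin 2) ℤ).map (Int.cast : ℤ → ℝ) * P⁻¹ =
      Matrix.diagonal ![Real.exp a₀, Real.exp (-a₀)]) (n : ℤ) :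
    P * ((B ^ n : Matrix.SpecialLinearGroup (Fin 2) ℤ) : Matrix (Fin 2) (Fin 2) ℤ).map
      (Int.cast : ℤ → ℝ) = Matrix.diagonal ![Real.exp (a₀ * n), Real.exp (-(a₀ * n))] * P := by
  have hmul : ∀ C D : Matrix.SpecialLinearGroup (Fin 2) ℤ,
      ((C * D : Matrix.SpecialLinearGroup (Fin 2) ℤ) : Matrix (Fin 2) (Fin 2) ℤ).map
        (Int.cast : ℤ → ℝ) =
      (C : Matrix (Fin 2) (Fin 2) ℤ).map (Int.cast : ℤ → ℝ) *
        (D : Matrix (Fin 2) (Fin 2) ℤ).map (Int.cast : ℤ → ℝ) := by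
    intro C D
    rw [Matrix.SpecialLinearGroup.coe_mul]
    exact Matrix.map_mul (f := Int.castRingHom ℝ)
  have h1 : P * (B : Matrix (Fin 2) (Fin 2) ℤ).map (Int.cast : ℤ → ℝ) =
      Matrix.diagonal ![Real.exp a₀, Real.exp (-a₀)] * P := by
    rw [← hB, Matrix.mul_assoc, Matrix.nonsing_inv_mul _ hP, Matrix.mul_one]
  have hone : Matrix.diagonal ![Real.exp 0, Real.exp (-0)] = (1 : Matrix (Fin 2) (Fin 2) ℝ) := by
    rw [← Matrix.diagonal_one]
    congr 1
    funext i
    fin_cases i <;> simp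
  have hmapone : ((1 : Matrix.SpecialLinearGroup (Fin 2) ℤ) : Matrix (Fin 2) (Fin 2) ℤ).map
      (Int.cast : ℤ → ℝ) = 1 := by
    rw [Matrix.SpecialLinearGroup.coe_one]
    exact Matrix.map_one _ (by simp) (by simp)
  have h2 : P * ((B⁻¹ : Matrix.SpecialLinearGroup (Fin 2) ℤ) : Matrix (Fin 2) (Fin 2) ℤ).map
      (Int.cast : ℤ → ℝ) = Matrix.diagonal ![Real.exp (-a₀), Real.exp (-(-a₀))] * P := by
    have h := hmul B B⁻¹
    rw [mul_inv_cancel, hmapone] at h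
    calc _ = Matrix.diagonal ![Real.exp (-a₀), Real.exp (-(-a₀))] *
          (Matrix.diagonal ![Real.exp a₀, Real.exp (-a₀)] * P) *
            ((B⁻¹ : Matrix.SpecialLinearGroup (Fin 2) ℤ) : Matrix (Fin 2) (Fin 2) ℤ).map
              (Int.cast : ℤ → ℝ) := by
          rw [← Matrix.mul_assoc, diagonal_exp_mul, neg_add_cancel, hone, Matrix.one_mul]
      _ = _ := by rw [← h1, Matrix.mul_assoc, Matrix.mul_assoc, ← h, Matrix.mul_one]
  induction n using Int.induction_on with
  | zero =>
    rw [zpow_zero, hmapone, Int.cast_zero, mul_zero, hone, Matrix.mul_one, Matrix.one_mul]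
  | succ n ih =>
    rw [zpow_add_one, hmul, ← Matrix.mul_assoc, ih, Matrix.mul_assoc, h1, ← Matrix.mul_assoc,
      diagonal_exp_mul]
    push_cast
    ring_nf
  | pred n ih =>
    rw [zpow_sub_one, hmul, ← Matrix.mul_assoc, ih, Matrix.mul_assoc, h2, ← Matrix.mul_assoc,
      diagonal_exp_mul]
    push_cast
    ring_nf

/-- With D = diag(e^{a₀}, e^{-a₀}), write the target as DⁿP r and split r into fractional and
integral parts. Since DⁿP = PBⁿ and Bⁿ is integral, the integral part contributes a vector of Pℤ².
-/
theorem exists_fract_decomposition (hP : IsUnit P.det)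
    (hB : P * (B : Matrix (Fin 2) (Fin 2) ℤ).map (Int.cast : ℤ → ℝ) * P⁻¹ =
      Matrix.diagonal ![Real.exp a₀, Real.exp (-a₀)]) (n : ℤ) (z₀ z₁ : ℝ) :
    ∃ (k : Fin 2 → ℤ) (s : Fin 2 → ℝ), (∀ i, 0 ≤ s i ∧ s i < 1) ∧
      Real.exp (a₀ * n) * (P 0 0 * s 0 + P 0 1 * s 1) + (P 0 0 * k 0 + P 0 1 * k 1) = z₀ ∧
      Real.exp (-(a₀ * n)) * (P 1 0 * s 0 + P 1 1 * s 1) + (P 1 0 * k 0 + P 1 1 * k 1) = z₁ := by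
  set C : Matrix (Fin 2) (Fin 2) ℤ := ↑(B ^ n : Matrix.SpecialLinearGroup (Fin 2) ℤ) with hC
  have hPC := mul_zpow_eq hP hB n
  rw [← hC] at hPC
  obtain ⟨r, hr⟩ : ∃ r : Fin 2 → ℝ,
      Matrix.mulVec (Matrix.diagonal ![Real.exp (a₀ * n), Real.exp (-(a₀ * n))] * P) r =
        ![z₀, z₁] := by
    refine ⟨Matrix.mulVec (P⁻¹ * Matrix.diagonal
      ![Real.exp (-(a₀ * n)), Real.exp (-(-(a₀ * n)))]) ![z₀, z₁], ?_⟩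
    rw [Matrix.mulVec_mulVec, Matrix.mul_assoc, ← Matrix.mul_assoc P,
      Matrix.mul_nonsing_inv _ hP, Matrix.one_mul, diagonal_exp_mul, add_neg_cancel]
    funext i
    fin_cases i <;> simp [Matrix.mulVec_diagonal]
  refine ⟨Matrix.mulVec C fun i => ⌊r i⌋, fun i => Int.fract (r i),
    fun i => ⟨Int.fract_nonneg _, Int.fract_lt_one _⟩, ?_, ?_⟩
  · have h0 := congrFun hr 0
    have hc0 := congrFun (congrFun hPC 0) 0
    have hc1 := congrFun (congrFun hPC 0) 1
    simp [Matrix.mul_apply, Matrix.mulVec, dotProduct, Fin.sum_univ_two, Matrix.diagonal_apply]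
      at h0 hc0 hc1 ⊢
    simp only [Int.fract]
    linear_combination h0 + (⌊r 0⌋ : ℝ) * hc0 + (⌊r 1⌋ : ℝ) * hc1
  · have h0 := congrFun hr 1
    have hc0 := congrFun (congrFun hPC 1) 0
    have hc1 := congrFun (congrFun hPC 1) 1
    simp [Matrix.mul_apply, Matrix.mulVec, dotProduct, Fin.sum_univ_two, Matrix.diagonal_apply]
      at h0 hc0 hc1 ⊢
    simp only [Int.fract]
    linear_combination h0 + (⌊r 0⌋ : ℝ) * hc0 + (⌊r 1⌋ : ℝ) * hc1

/-- The translates of the fundamental domain cover `G`. -/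
theorem exists_leftMul_eq (ha₀ : a₀ ≠ 0) (hP : IsUnit P.det)
    (hB : P * (B : Matrix (Fin 2) (Fin 2) ℤ).map (Int.cast : ℤ → ℝ) * P⁻¹ =
      Matrix.diagonal ![Real.exp a₀, Real.exp (-a₀)]) (x : E) :
    ∃ g ∈ lattice a₀ P, ∃ d ∈ fundDomain a₀ P, leftMul g d = x := by
  set n : ℤ := ⌊x 0 / a₀⌋
  set m : ℤ := ⌊x 1⌋
  obtain ⟨k, s, hs, hz₀, hz₁⟩ := exists_fract_decomposition hP hB n (x 4) (x 5)
  -- The group law adds x eᵗz' to the y-coordinates. That shear term, fixed by the z-part just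
  -- chosen, is subtracted before reducing y.
  obtain ⟨l, r, hr, hy₀, hy₁⟩ := exists_fract_decomposition hP hB n
    (x 2 - Real.exp (a₀ * n) * (m * (P 0 0 * s 0 + P 0 1 * s 1)))
    (x 3 - Real.exp (-(a₀ * n)) * (m * (P 1 0 * s 0 + P 1 1 * s 1)))
  refine ⟨_, ⟨![n, m, l 0, l 1, k 0, k 1], rfl⟩, _,
    ⟨![Int.fract (x 0 / a₀), Int.fract (x 1), r 0, r 1, s 0, s 1], ?_, rfl⟩, ?_⟩
  · intro i
    fin_cases i
    · exact ⟨Int.fract_nonneg _, Int.fract_lt_one _⟩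
    · exact ⟨Int.fract_nonneg _, Int.fract_lt_one _⟩
    · exact hr 0
    · exact hr 1
    · exact hs 0
    · exact hs 1
  · have h0 : a₀ * n + a₀ * Int.fract (x 0 / a₀) = x 0 := by
      rw [← mul_add, Int.floor_add_fract]
      field_simp
    have h1 : (m : ℝ) + Int.fract (x 1) = x 1 := Int.floor_add_fract _
    funext i
    fin_cases i
    · simpa [leftMul, latticeMap] using h0
    · simpa [leftMul, latticeMap] using h1
    · simp [leftMul, latticeMap]
      linear_combination hy₀
    · simp [leftMul, latticeMap]
      linear_combination hy₁
    · simp [leftMul, latticeMap]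
      linear_combination hz₀
    · simp [leftMul, latticeMap]
      linear_combination hz₁

/-- A function on `G` that descends to `X = Γ \ G`. -/
def IsInvariant (a₀ : ℝ) (P : Matrix (Fin 2) (Fin 2) ℝ) (f : E → ℂ) : Prop :=
  ∀ g ∈ lattice a₀ P, ∀ x, f (leftMul g x) = f x

theorem IsInvariant.bounded (hcov : ∀ x, ∃ g ∈ lattice a₀ P, ∃ d ∈ fundDomain a₀ P, leftMul g d = x)
    {f : E → ℂ} (hf : IsInvariant a₀ P f) (hc : Continuous f) : ∃ C, ∀ x, ‖f x‖ ≤ C := by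
  have hm : Continuous (latticeMap a₀ P) := by
    refine continuous_pi fun j => ?_
    fin_cases j <;> simp [latticeMap] <;> fun_prop
  have hK : IsCompact (latticeMap a₀ P '' Set.Icc 0 1) := isCompact_Icc.image hm
  obtain ⟨C, hC⟩ := hK.exists_bound_of_continuousOn hc.continuousOn
  refine ⟨C, fun x => ?_⟩
  obtain ⟨g, hg, d, ⟨s, hs, rfl⟩, rfl⟩ := hcov x
  rw [hf g hg]
  exact hC _ ⟨s, ⟨fun i => (hs i).1, fun i => (hs i).2.le⟩, rfl⟩

theorem countable_lattice : (lattice a₀ P).Countable := by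
  have h : lattice a₀ P ⊆ Set.range fun m : Fin 6 → ℤ => latticeMap a₀ P fun i => (m i : ℝ) := by
    rintro g ⟨m, rfl⟩
    exact ⟨m, rfl⟩
  exact (Set.countable_range _).mono h

/-- Countably many translates of the domain cover G and left translations preserve null sets, so f
vanishes almost everywhere on G; continuity does the rest. -/
theorem IsInvariant.eq_zero
    (hcov : ∀ x, ∃ g ∈ lattice a₀ P, ∃ d ∈ fundDomain a₀ P, leftMul g d = x)
    {f : E → ℂ} (hf : IsInvariant a₀ P f) (hc : Continuous f)
    (h0 : ∀ᵐ x ∂(MeasureTheory.volume : MeasureTheory.Measure E), x ∈ fundDomain a₀ P → f x = 0) :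
    ∀ x, f x = 0 := by
  have hsub : {x | ¬ f x = 0} ⊆
      ⋃ g ∈ lattice a₀ P, leftMul g '' {x | ¬ (x ∈ fundDomain a₀ P → f x = 0)} := by
    intro x hx
    obtain ⟨g, hg, d, hd, rfl⟩ := hcov x
    refine Set.mem_biUnion hg ⟨d, fun h => hx ?_, rfl⟩
    rw [hf g hg]
    exact h hd
  have hae : f =ᵐ[(MeasureTheory.volume : MeasureTheory.Measure E)] fun _ => 0 := by
    refine MeasureTheory.measure_mono_null hsub ?_
    refine (MeasureTheory.measure_biUnion_null_iff countable_lattice).2 fun g _ => ?_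
    exact MeasureTheory.addHaar_image_eq_zero_of_differentiableOn_of_addHaar_eq_zero _
      (fun x _ => (hasFDerivAt_leftMul g x).differentiableAt.differentiableWithinAt) h0
  exact congrFun ((hc.ae_eq_iff_eq _ continuous_const).1 hae)

variable {p : ℕ}

theorem isInvariant_coeff {ψ : Form (p + 0)} (hψ : ψ ∈ A a₀ P p 0) (w : Fin (p + 0) → E) :
    IsInvariant a₀ P (coeff ψ w) := by
  intro g hg x
  have h := hψ.2.1 g hg x
  rw [(hasFDerivAt_leftMul g x).fderiv] at h
  rw [coeff, coeff, ← h]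
  simp only [frameMap_leftMul]
  rfl

theorem IsInvariant.fderiv {f : E → ℂ} (hf : IsInvariant a₀ P f) (hd : Differentiable ℝ f)
    (u : E) : IsInvariant a₀ P fun x => fderiv ℝ f x (frameMap x u) := by
  intro g hg x
  have h : f = f ∘ leftMul g := funext fun y => (hf g hg y).symm
  change _root_.fderiv ℝ f (leftMul g x) (frameMap (leftMul g x) u) =
    _root_.fderiv ℝ f x (frameMap x u)
  conv_rhs => rw [h]
  rw [fderiv_comp x (hd _) (hasFDerivAt_leftMul g x).differentiableAt,
    (hasFDerivAt_leftMul g x).fderiv, frameMap_leftMul]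
  rfl

theorem isTypeTop_of_mem {ψ : Form (p + 0)} (hψ : ψ ∈ A a₀ P p 0) (x : E) :
    IsTypeTop (J x) (ψ x) :=
  (typeProj_top_eq_self_iff (k := p) (J_J x) (ψ x)).1 (hψ.2.2 x)

theorem isInvariant_dbarCoeff {ψ : Form (p + 0)} (hψ : ψ ∈ A a₀ P p 0) (u : E)
    (w : Fin (p + 0) → E) : IsInvariant a₀ P (dbarCoeff ψ u w) := by
  intro g hg x
  have h := fun u w => (isInvariant_coeff hψ w).fderiv (differentiable_coeff hψ.1 w) u g hg x
  simp only at h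
  simp only [dbarCoeff, h, fun w => isInvariant_coeff hψ w g hg x]

theorem continuous_dbarCoeff {ψ : Form p} (hψ : ContDiff ℝ ∞ ψ) (u : E)
    (w : Fin p → E) : Continuous (dbarCoeff ψ u w) :=
  ((continuous_fderiv_coeff hψ u w).add
    (continuous_const.mul (continuous_fderiv_coeff hψ _ w))).sub
      (continuous_finsetSum _ fun _ _ => (differentiable_coeff hψ _).continuous)

/-! ### Definiteness of the L² product and harmonic forms of type (p,0) -/

theorem eq_zero_of_frame {k : ℕ} {x : E} {α : E [⋀^Fin k]→L[ℝ] ℂ}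
    (h : ∀ I : Fin k → Fin 6, α (fun j => frame x (I j)) = 0) : α = 0 := by
  have h' : (α.compContinuousLinearMap (frameMap x)).toAlternatingMap.toMultilinearMap = 0 := by
    refine Module.Basis.ext_multilinear (fun _ => Pi.basisFun ℝ (Fin 6)) fun I => ?_
    change α (fun j => frameMap x (Pi.basisFun ℝ (Fin 6) (I j))) = 0
    simp only [Pi.basisFun_apply, frameMap_single, h]
  ext v
  choose w hw using fun j => frameMap_surjective x (v j)
  rw [← funext hw]
  exact congrArg (fun f => f w) h'

theorem formInner_self {k : ℕ} (x : E) (α : E [⋀^Fin k]→L[ℝ] ℂ) :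
    formInner x α α = ((1 / (k.factorial : ℝ) * ∑ I : Fin k → Fin 6,
      ‖α (fun j => frame x (I j))‖ ^ 2 : ℝ) : ℂ) := by
  rw [formInner]
  push_cast
  congr 1
  exact Finset.sum_congr rfl fun I _ => Complex.mul_conj' _

theorem L2_self_eq_zero {k : ℕ} {α : Form k} (hα : ContCoeff α) (h : L2 a₀ P α α = 0) :
    ∀ᵐ x ∂(MeasureTheory.volume : MeasureTheory.Measure E), x ∈ fundDomain a₀ P → α x = 0 := by
  set F : E → ℝ := fun x => 1 / (k.factorial : ℝ) * ∑ I : Fin k → Fin 6,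
    ‖α x (fun j => frame x (I j))‖ ^ 2 with hF
  have hFc : Continuous F := continuous_const.mul
    (continuous_finsetSum _ fun I _ => (hα I).norm.pow 2)
  have hint : MeasureTheory.IntegrableOn F (fundDomain a₀ P) := by
    have h := (integrable_inner a₀ P hα hα).re
    refine h.congr (Filter.Eventually.of_forall fun x => ?_)
    simp only [formInner_self]
    exact Complex.ofReal_re _
  have h0 : ∫ x in fundDomain a₀ P, F x = 0 := by
    have : L2 a₀ P α α = ((∫ x in fundDomain a₀ P, F x : ℝ) : ℂ) := by
      rw [L2, ← integral_complex_ofReal]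
      simp only [formInner_self, hF]
    rw [this] at h
    exact_mod_cast h
  have hnn : 0 ≤ F := fun x => by positivity
  have hae := (MeasureTheory.integral_eq_zero_iff_of_nonneg hnn hint).1 h0
  -- Measurability of the zero set of F suffices here; that of `fundDomain` is not required.
  have hae' := (MeasureTheory.ae_restrict_iff
    (p := fun x => F x = 0) (measurableSet_eq_fun hFc.measurable measurable_const)).1 hae
  filter_upwards [hae'] with x hx hxD
  refine eq_zero_of_frame (x := x) fun I => ?_
  have hx' : 1 / (k.factorial : ℝ) * ∑ I : Fin k → Fin 6,
    ‖α x (fun j => frame x (I j))‖ ^ 2 = 0 := hx hxD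
  have hk : (1 / (k.factorial : ℝ)) ≠ 0 := by positivity
  have hs := (mul_eq_zero.1 hx').resolve_left hk
  rw [Finset.sum_eq_zero_iff_of_nonneg fun _ _ => by positivity] at hs
  simpa using hs I (Finset.mem_univ I)

/-- The harmonic forms of type `(p,0)` are the `∂̄`-closed ones. -/
theorem mem_harmonic_iff
    (hcov : ∀ x, ∃ g ∈ lattice a₀ P, ∃ d ∈ fundDomain a₀ P, leftMul g d = x)
    {ψ : Form (p + 0)} :
    ψ ∈ harmonic a₀ P p 0 ↔ ψ ∈ A a₀ P p 0 ∧ ∀ u w x, dbarCoeff ψ u w x = 0 := by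
  constructor
  · rintro ⟨hψ, -, h⟩
    refine ⟨hψ, fun u w => ?_⟩
    -- Taking ψ itself as the test form gives ‖∂̄ψ‖² = ⟨ψ, ∂̄*∂̄ψ⟩ = 0.
    have h0 : L2 a₀ P (dbar p 0 ψ) (dbar p 0 ψ) = 0 := by
      rw [h ψ hψ]
      simp [L2, formInner]
    refine (isInvariant_dbarCoeff hψ u w).eq_zero hcov (continuous_dbarCoeff hψ.1 u w) ?_
    filter_upwards [L2_self_eq_zero (contCoeff_dbar hψ.1) h0] with x hx hxD
    exact (dbar_eq_zero_iff hψ.1 (isTypeTop_of_mem hψ) x).1 (hx hxD) u w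
  · rintro ⟨hψ, h⟩
    have h0 : dbar p 0 ψ = 0 := funext fun x =>
      (dbar_eq_zero_iff hψ.1 (isTypeTop_of_mem hψ) x).2 fun u w => h u w x
    refine ⟨hψ, ?_⟩
    change IsDbarStar a₀ P p 0 (dbar p 0 ψ) 0
    rw [h0]
    exact IsDbarStar.zero

end Lattice

/-! ### A Liouville theorem -/

/-- A bounded function on `ℂ` with constant `∂̄`-derivative is constant. -/
theorem eq_of_bounded_of_dbar_const {h : ℂ → ℂ} (hd : Differentiable ℝ h) {C : ℝ}
    (hb : ∀ z, ‖h z‖ ≤ C) {c : ℂ}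
    (hc : ∀ z, fderiv ℝ h z 1 + Complex.I * fderiv ℝ h z Complex.I = c) (z w : ℂ) :
    h z = h w := by
  -- The constant c cancels in a difference of translates, which is therefore entire and bounded; by
  -- Liouville's theorem the increment of h does not depend on the base point.
  have hdiff : ∀ w z z', h (z + w) - h z = h (z' + w) - h z' := by
    intro w
    have hk : Differentiable ℂ fun z => h (z + w) - h z := by
      intro z
      have h1 : HasFDerivAt (fun z => h (z + w)) (fderiv ℝ h (z + w)) z :=
        (hd (z + w)).hasFDerivAt.comp z ((hasFDerivAt_id z).add_const w)
      have h2 := h1.fun_sub (hd z).hasFDerivAt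
      refine differentiableAt_complex_iff_differentiableAt_real.2 ⟨h2.differentiableAt, ?_⟩
      rw [h2.fderiv]
      simp only [sub_apply, smul_eq_mul]
      linear_combination (-Complex.I) * hc (z + w) + Complex.I * hc z +
        (fderiv ℝ h (z + w) Complex.I - fderiv ℝ h z Complex.I) * Complex.I_mul_I
    refine hk.apply_eq_apply_of_bounded ?_
    refine isBounded_iff_forall_norm_le.2 ⟨C + C, ?_⟩
    rintro _ ⟨z, rfl⟩
    exact (norm_sub_le _ _).trans (add_le_add (hb _) (hb _))
  -- Base-point independent increments grow linearly along multiples of w, which boundedness allows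
  -- only if they vanish.
  have hn : ∀ (w : ℂ) (n : ℕ), h (n * w) - h 0 = n * (h w - h 0) := by
    intro w n
    induction n with
    | zero => simp
    | succ n ih =>
      have h1 := hdiff w (n * w) 0
      rw [zero_add] at h1
      push_cast
      rw [add_mul, one_mul]
      linear_combination h1 + ih
  have h0 : ∀ w, h w = h 0 := by
    intro w
    by_contra hne
    have hpos : 0 < ‖h w - h 0‖ := norm_pos_iff.2 (sub_ne_zero.2 hne)
    obtain ⟨n, hn'⟩ := exists_nat_gt ((C + C) / ‖h w - h 0‖)
    rw [div_lt_iff₀ hpos] at hn'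
    have h1 : ‖h (n * w) - h 0‖ ≤ C + C :=
      (norm_sub_le _ _).trans (add_le_add (hb _) (hb _))
    rw [hn, norm_mul, Complex.norm_natCast] at h1
    exact absurd hn' (not_lt.2 h1)
  rw [h0 z, h0 w]

/-- The basis `e₁, e₃, e₅` of the Lie algebra of `G` over `ℂ`. -/
def hol : Fin 3 → E := ![Pi.single 0 1, Pi.single 2 1, Pi.single 4 1]

/-- Twice the derivative along the antiholomorphic vector `V̄ j`. -/
def dbarFun (f : E → ℂ) (j : Fin 3) (x : E) : ℂ :=
  fderiv ℝ f x (frameMap x (hol j)) + Complex.I * fderiv ℝ f x (frameMap x (J 0 (hol j)))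

theorem J_zero_hol (j : Fin 3) : J 0 (hol j) =
    ![Pi.single 1 1, Pi.single 3 1, Pi.single 5 1] j := by
  funext i
  fin_cases j <;> fin_cases i <;> simp [J_zero_apply, hol]

/-- The pair for j = 0 spans the (t,x)-directions and is constant. The other pairs depend only on t
and x, which do not change along their planes. -/
theorem frameMap_plane (j : Fin 3) (x : E) (s r : ℝ) :
    frameMap (x + (s • frameMap x (hol j) + r • frameMap x (J 0 (hol j)))) (hol j) =
        frameMap x (hol j) ∧
      frameMap (x + (s • frameMap x (hol j) + r • frameMap x (J 0 (hol j)))) (J 0 (hol j)) =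
        frameMap x (J 0 (hol j)) := by
  constructor <;> fin_cases j <;> simp [frameMap_apply, J_zero_apply, hol, Matrix.vecHead, Matrix.vecTail]

section Liouville

variable {a₀ : ℝ} {P : Matrix (Fin 2) (Fin 2) ℝ} {f : E → ℂ}

/-- Restriction to the affine leaf through x turns W_j into ∂_s + i∂_r on ℂ, where boundedness of f
applies. -/
theorem fderiv_eq_zero_of_dbarFun_const
    (hcov : ∀ x, ∃ g ∈ lattice a₀ P, ∃ d ∈ fundDomain a₀ P, leftMul g d = x)
    (hf : IsInvariant a₀ P f) (hd : Differentiable ℝ f) {j : Fin 3} {c : ℂ}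
    (hc : ∀ x, dbarFun f j x = c) (x : E) :
    fderiv ℝ f x (frameMap x (hol j)) = 0 ∧ fderiv ℝ f x (frameMap x (J 0 (hol j))) = 0 := by
  obtain ⟨C, hC⟩ := hf.bounded hcov hd.continuous
  let l : ℂ →L[ℝ] E := Complex.reCLM.smulRight (frameMap x (hol j)) +
    Complex.imCLM.smulRight (frameMap x (J 0 (hol j)))
  have hl : ∀ z, l z = z.re • frameMap x (hol j) + z.im • frameMap x (J 0 (hol j)) :=
    fun z => rfl
  have hh : ∀ z, HasFDerivAt (fun z => f (x + l z)) (fderiv ℝ f (x + l z) ∘L l) z := fun z =>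
    (hd (x + l z)).hasFDerivAt.comp z (l.hasFDerivAt.const_add x)
  have h1 : l 1 = frameMap x (hol j) := by simp [hl]
  have h2 : l Complex.I = frameMap x (J 0 (hol j)) := by simp [hl]
  have hconst := eq_of_bounded_of_dbar_const (h := fun z => f (x + l z))
    (fun z => (hh z).differentiableAt) (fun z => hC _) (c := c) fun z => by
      rw [(hh z).fderiv]
      have hp := frameMap_plane j x z.re z.im
      rw [← hl] at hp
      have := hc (x + l z)
      rw [dbarFun, hp.1, hp.2] at this
      simpa [h1, h2] using this
  have hz : (fun z => f (x + l z)) = fun _ => f (x + l 0) := funext fun z => hconst z 0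
  have h0 := (hh 0).fderiv
  rw [hz] at h0
  have e1 := congrArg (fun L => L 1) h0
  have e2 := congrArg (fun L => L Complex.I) h0
  simp [h1, h2] at e1 e2
  exact ⟨e1.symm, e2.symm⟩

/-- This is the device that eliminates coefficients: a constant that is a W_j-derivative of an
invariant function must vanish. -/
theorem eq_zero_of_dbarFun_const
    (hcov : ∀ x, ∃ g ∈ lattice a₀ P, ∃ d ∈ fundDomain a₀ P, leftMul g d = x)
    (hf : IsInvariant a₀ P f) (hd : Differentiable ℝ f) {j : Fin 3} {c : ℂ}
    (hc : ∀ x, dbarFun f j x = c) : c = 0 := by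
  have h := fderiv_eq_zero_of_dbarFun_const hcov hf hd hc 0
  rw [← hc 0, dbarFun, h.1, h.2]
  simp

theorem exists_eq_const
    (hcov : ∀ x, ∃ g ∈ lattice a₀ P, ∃ d ∈ fundDomain a₀ P, leftMul g d = x)
    (hf : IsInvariant a₀ P f) (hd : Differentiable ℝ f) (h : ∀ j x, dbarFun f j x = 0) :
    ∃ c, ∀ x, f x = c := by
  refine ⟨f 0, fun x => is_const_of_fderiv_eq_zero hd (fun y => ?_) x 0⟩
  have hj := fun j => fderiv_eq_zero_of_dbarFun_const hcov hf hd (h j) y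
  simp only [J_zero_hol] at hj
  have hall : (fderiv ℝ f y ∘L frameMap y).toLinearMap = 0 := by
    refine (Pi.basisFun ℝ (Fin 6)).ext fun i => ?_
    rw [Pi.basisFun_apply]
    fin_cases i
    · exact (hj 0).1
    · exact (hj 0).2
    · exact (hj 1).1
    · exact (hj 1).2
    · exact (hj 2).1
    · exact (hj 2).2
  ext v
  obtain ⟨w, rfl⟩ := frameMap_surjective y v
  exact congrArg (fun L => L w) hall

end Liouville

/-! ### Left-invariant forms of type `(p,0)` -/

section Invariant

variable {p : ℕ} {a₀ : ℝ} {P : Matrix (Fin 2) (Fin 2) ℝ}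

/-- These three nonzero constants are all that the Lie algebra contributes to the system ∂̄ψ = 0. -/
theorem antiBracketLinear_hol (j i : Fin 3) : antiBracketLinear (hol j) (hol i) =
    if j = 0 ∧ i = 2 then J 0 (hol 1) else if j = 1 ∧ i = 0 then -hol 1
      else if j = 2 ∧ i = 0 then -hol 2 else 0 := by
  funext l
  fin_cases j <;> fin_cases i <;> fin_cases l <;>
    simp [antiBracketLinear, antiBracket, bracket, conn, J_zero_apply, hol] <;> norm_num

/-- Forms of type `(p,0)` are determined by their coefficients on `e₁, e₃, e₅`. -/
theorem eq_of_coeff_hol_eq {ψ φ : Form p} (hψ : ∀ x, IsTypeTop (J x) (ψ x))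
    (hφ : ∀ x, IsTypeTop (J x) (φ x))
    (h : ∀ (K : Fin p → Fin 3) x, coeff ψ (fun m => hol (K m)) x = coeff φ (fun m => hol (K m)) x) :
    ψ = φ := by
  funext x
  rw [← sub_eq_zero]
  refine eq_zero_of_frame (x := x) fun I => ?_
  have hI : ∃ (K : Fin p → Fin 3) (T : Finset (Fin p)),
      (fun j => frame x (I j)) = fun j => frameMap x (applyOn (J 0) T (fun m => hol (K m)) j) := by
    refine ⟨fun j => ![0, 0, 1, 1, 2, 2] (I j), Finset.univ.filter fun j => I j = 1 ∨ I j = 3 ∨ I j = 5, ?_⟩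
    funext j
    rw [← frameMap_single]
    congr 1
    simp only [applyOn, J_zero_hol, Finset.mem_filter, Finset.mem_univ, true_and]
    generalize I j = i
    fin_cases i <;> simp [hol]
  obtain ⟨K, T, hKT⟩ := hI
  have h1 := (isTypeTop_coeff (hψ x)).applyOn T fun m => hol (K m)
  have h2 := (isTypeTop_coeff (hφ x)).applyOn T fun m => hol (K m)
  rw [hKT]
  change coeff ψ _ x - coeff φ _ x = 0
  rw [h1, h2, h, sub_self]

/-- Evaluation on one fixed frame embeds the alternating forms linearly in a finite-dimensional
space, and a linear left inverse is automatically smooth. -/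
theorem contDiff_form {k : ℕ} {ψ : Form k} (h : ∀ v, ContDiff ℝ ∞ fun x => ψ x v) :
    ContDiff ℝ ∞ ψ := by
  let ev : (E [⋀^Fin k]→L[ℝ] ℂ) →ₗ[ℝ] ((Fin k → Fin 6) → ℂ) :=
    { toFun := fun α I => α fun j => frame 0 (I j)
      map_add' := fun _ _ => rfl
      map_smul' := fun _ _ => rfl }
  have hinj : LinearMap.ker ev = ⊥ := by
    rw [LinearMap.ker_eq_bot']
    exact fun α hα => eq_zero_of_frame (x := 0) fun I => congrFun hα I
  obtain ⟨L, hL⟩ := ev.exists_leftInverse_of_injective hinj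
  have hψ : ψ = fun x => L.toContinuousLinearMap (ev (ψ x)) :=
    funext fun x => (congrArg (fun l => l (ψ x)) hL).symm
  rw [hψ]
  exact L.toContinuousLinearMap.contDiff.comp (contDiff_pi.2 fun I => h _)

/-- The determinant as a continuous alternating map. -/
def detAlternating (p : ℕ) : (Fin p → ℂ) [⋀^Fin p]→L[ℂ] ℂ where
  toContinuousMultilinearMap :=
    { toMultilinearMap := (Matrix.detRowAlternating (n := Fin p) (R := ℂ)).toMultilinearMap
      cont := Continuous.matrix_det (A := fun M : Matrix (Fin p) (Fin p) ℂ => M) continuous_id }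
  map_eq_zero_of_eq' := (Matrix.detRowAlternating (n := Fin p) (R := ℂ)).map_eq_zero_of_eq'

/-- The form `Φ^{I 0} ∧ ⋯ ∧ Φ^{I (p-1)}`. -/
def PhiWedge (I : Fin p → Fin 3) : Form p := fun x =>
  ((detAlternating p).restrictScalars ℝ).compContinuousLinearMap
    (ContinuousLinearMap.pi fun a => Phi x (I a))

theorem PhiWedge_apply (I : Fin p → Fin 3) (x : E) (v : Fin p → E) :
    PhiWedge I x v = Matrix.det (Matrix.of fun b a => Phi x (I a) (v b)) := rfl

theorem Phi_frameMap (x w : E) (j : Fin 3) : Phi x j (frameMap x w) =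
    ![(w 0 + w 1 * Complex.I : ℂ), w 2 + w 3 * Complex.I, w 4 + w 5 * Complex.I] j := by
  have hx : (Real.exp (x 0) : ℂ) ≠ 0 := by exact_mod_cast (Real.exp_pos _).ne'
  fin_cases j <;>
    simp [Phi, coframe, dcoord, frameMap_apply, Real.exp_neg, -Complex.ofReal_exp] <;>
    field_simp <;> ring

theorem coeff_PhiWedge (I : Fin p → Fin 3) (w : Fin p → E) (x : E) :
    coeff (PhiWedge I) w x = Matrix.det (Matrix.of fun b a => Phi 0 (I a) (frameMap 0 (w b))) := by
  rw [coeff, PhiWedge_apply]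
  simp only [Phi_frameMap]

theorem isTypeTop_PhiWedge (I : Fin p → Fin 3) (x : E) : IsTypeTop (J x) (PhiWedge I x) := by
  intro l v
  have h := (detAlternating p).map_update_smul (fun b a => Phi x (I a) (v b)) l Complex.I
    (fun a => Phi x (I a) (v l))
  rw [Function.update_eq_self l fun b a => Phi x (I a) (v b)] at h
  refine Eq.trans ?_ h
  change detAlternating p (fun b a => Phi x (I a) (Function.update v l (J x (v l)) b)) = _
  congr 1
  funext b a
  rcases eq_or_ne b l with rfl | hb
  · simp [Phi_J]
  · simp [hb]

theorem contDiff_PhiWedge (I : Fin p → Fin 3) : ContDiff ℝ ∞ (PhiWedge I) := by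
  refine contDiff_form fun v => ?_
  simp only [PhiWedge_apply, Matrix.det_apply']
  refine ContDiff.sum fun σ _ => contDiff_const.mul (contDiff_prod fun i _ => ?_)
  simp only [Matrix.of_apply]
  have hc : ∀ j u, ContDiff ℝ ∞ fun x => (coframe x j u : ℂ) := by
    intro j u
    refine Complex.ofRealCLM.contDiff.comp ?_
    fin_cases j <;> simp [coframe, dcoord] <;> fun_prop
  generalize I i = j
  fin_cases j
  · exact (hc 0 _).add (contDiff_const.mul (hc 1 _))
  · exact (hc 2 _).add (contDiff_const.mul (hc 3 _))
  · exact (hc 4 _).add (contDiff_const.mul (hc 5 _))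

theorem PhiWedge_mem (I : Fin p → Fin 3) : (PhiWedge I : Form (p + 0)) ∈ A a₀ P p 0 := by
  refine ⟨contDiff_PhiWedge I, fun g _ x => ?_, fun x =>
    (typeProj_top_eq_self_iff (k := p) (J_J x) _).2 (isTypeTop_PhiWedge I x)⟩
  rw [(hasFDerivAt_leftMul g x).fderiv]
  ext v
  choose w hw using fun j => frameMap_surjective x (v j)
  rw [← funext hw]
  change PhiWedge I (leftMul g x) (fun j => frameMap g (frameMap x (w j))) = _
  simp only [← frameMap_leftMul]
  exact (coeff_PhiWedge I w _).trans (coeff_PhiWedge I w _).symm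

/-- In the order Φ^1, Φ^3, Φ^2 the action on the coframe is strictly triangular: each form is sent
to a combination of its predecessors. -/
theorem Phi_antiBracketLinear (u w : E) :
    Phi 0 0 (frameMap 0 (antiBracketLinear u w)) = 0 ∧
    Phi 0 1 (frameMap 0 (antiBracketLinear u w)) =
      -(conj (Phi 0 1 (frameMap 0 u)) * Phi 0 0 (frameMap 0 w)) +
        Complex.I * conj (Phi 0 0 (frameMap 0 u)) * Phi 0 2 (frameMap 0 w) ∧
    Phi 0 2 (frameMap 0 (antiBracketLinear u w)) =
      -(conj (Phi 0 2 (frameMap 0 u)) * Phi 0 0 (frameMap 0 w)) := by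
  simp only [Phi_frameMap]
  refine ⟨?_, ?_, ?_⟩ <;> apply Complex.ext <;>
    simp [antiBracketLinear, antiBracket, bracket, conn, J_zero_apply] <;> ring

theorem dbarCoeff_PhiWedge (I : Fin p → Fin 3) (u : E) (w : Fin p → E) (x : E) :
    dbarCoeff (PhiWedge I) u w x = -∑ m, Matrix.det (Matrix.of fun b a =>
      Phi 0 (I a) (frameMap 0 (Function.update w m (antiBracketLinear u (w m)) b))) := by
  have h : coeff (PhiWedge I) w = fun _ => _ := funext fun x => coeff_PhiWedge I w x
  rw [dbarCoeff, h]
  simp [coeff_PhiWedge]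

/-- The three wedges are built from initial segments of the flag Φ^1, Φ^3, Φ^2. Strict triangularity
makes every term of the derivation repeat a factor, so it vanishes. -/
theorem PhiWedge_mem_harmonic
    (hcov : ∀ x, ∃ g ∈ lattice a₀ P, ∃ d ∈ fundDomain a₀ P, leftMul g d = x) :
    (PhiWedge ![0] : Form (1 + 0)) ∈ harmonic a₀ P 1 0 ∧
    (PhiWedge ![0, 2] : Form (2 + 0)) ∈ harmonic a₀ P 2 0 ∧
    (PhiWedge ![0, 1, 2] : Form (3 + 0)) ∈ harmonic a₀ P 3 0 := by
  refine ⟨(mem_harmonic_iff hcov).2 ⟨PhiWedge_mem _, fun u w x => ?_⟩,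
    (mem_harmonic_iff hcov).2 ⟨PhiWedge_mem _, fun u w x => ?_⟩,
    (mem_harmonic_iff hcov).2 ⟨PhiWedge_mem _, fun u w x => ?_⟩⟩
  · refine (dbarCoeff_PhiWedge (p := 1) _ u w x).trans ?_
    simp [(Phi_antiBracketLinear _ _).1]
  · refine (dbarCoeff_PhiWedge (p := 2) _ u w x).trans ?_
    simp [Fin.sum_univ_succ, Matrix.det_fin_two, Function.update_apply, Phi_antiBracketLinear]
    ring
  · refine (dbarCoeff_PhiWedge (p := 3) _ u w x).trans ?_
    simp [Fin.sum_univ_succ, Matrix.det_fin_three, Function.update_apply, Phi_antiBracketLinear]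
    ring

end Invariant

/-! ### Harmonic forms of type `(p,0)` -/

section Harmonic

variable {p : ℕ} {a₀ : ℝ} {P : Matrix (Fin 2) (Fin 2) ℝ}

/-- The action of `antiBracketLinear (hol j)` in a slot occupied by `hol i`, for a complex linear
function with values `g` on `hol 0, hol 1, hol 2`. -/
def structTerm (j i : Fin 3) (g : Fin 3 → ℂ) : ℂ :=
  if j = 0 ∧ i = 2 then Complex.I * g 1 else if j = 1 ∧ i = 0 then -g 1
    else if j = 2 ∧ i = 0 then -g 2 else 0

theorem hol_update (K : Fin p → Fin 3) (m : Fin p) (b : Fin 3) :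
    Function.update (fun l => hol (K l)) m (hol b) = fun l => hol (Function.update K m b l) := by
  funext l
  rcases eq_or_ne l m with rfl | hl
  · simp
  · simp [hl]

/-- The equation `∂̄ψ = 0` in the left-invariant frame. -/
theorem dbarFun_coeff_hol {ψ : Form p} (hJ : ∀ x, IsTypeTop (J x) (ψ x))
    (h0 : ∀ u w x, dbarCoeff ψ u w x = 0) (j : Fin 3) (K : Fin p → Fin 3) (x : E) :
    dbarFun (coeff ψ fun l => hol (K l)) j x =
      ∑ m, structTerm j (K m) fun b => coeff ψ (fun l => hol (Function.update K m b l)) x := by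
  have h := h0 (hol j) (fun l => hol (K l)) x
  rw [dbarCoeff, sub_eq_zero] at h
  rw [dbarFun, h]
  refine Finset.sum_congr rfl fun m _ => ?_
  rw [antiBracketLinear_hol, structTerm]
  have hneg : ∀ b, coeff ψ (Function.update (fun l => hol (K l)) m (-hol b)) x =
      -coeff ψ (Function.update (fun l => hol (K l)) m (hol b)) x := by
    intro b
    rw [coeff_update, coeff_update, map_neg, map_update_neg']
  split_ifs
  · rw [(isTypeTop_coeff (hJ x)).update_J, hol_update]
  · rw [hneg, hol_update]
  · rw [hneg, hol_update]
  · rw [coeff_update, map_zero]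
    exact (ψ x).map_update_zero _ m

theorem coeff_hol_eq_zero (ψ : Form p) {K : Fin p → Fin 3} {i j : Fin p} (hK : K i = K j)
    (hij : i ≠ j) (x : E) : coeff ψ (fun l => hol (K l)) x = 0 :=
  (ψ x).map_eq_zero_of_eq _ (by simp only [hK]) hij

theorem coeff_hol_swap (ψ : Form p) (K : Fin p → Fin 3) {i j : Fin p} (hij : i ≠ j) (x : E) :
    coeff ψ (fun l => hol (K (Equiv.swap i j l))) x = -coeff ψ (fun l => hol (K l)) x :=
  (ψ x).toAlternatingMap.map_swap (fun l => frameMap x (hol (K l))) hij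

theorem coeff_smul (c : ℂ) (ψ : Form p) (w : Fin p → E) (x : E) :
    coeff (c • ψ) w x = c * coeff ψ w x := rfl

theorem Phi_zero_hol (i k : Fin 3) : Phi 0 i (frameMap 0 (hol k)) = if i = k then 1 else 0 := by
  rw [Phi_frameMap]
  fin_cases i <;> fin_cases k <;> simp [hol]

theorem coeff_PhiWedge_hol (I K : Fin p → Fin 3) (x : E) :
    coeff (PhiWedge I) (fun l => hol (K l)) x =
      Matrix.det (Matrix.of fun b a => if I a = K b then (1 : ℂ) else 0) := by
  simp only [coeff_PhiWedge, Phi_zero_hol]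

/-- The Hodge number is one as soon as `Φ^I` is harmonic and the coefficients of any harmonic form
are those of a multiple of `Φ^I`. -/
theorem hodgeNumber_eq_one
    (hcov : ∀ x, ∃ g ∈ lattice a₀ P, ∃ d ∈ fundDomain a₀ P, leftMul g d = x)
    {I : Fin p → Fin 3} (hI : Function.Injective I)
    (hmem : (PhiWedge I : Form (p + 0)) ∈ harmonic a₀ P p 0)
    (h : ∀ ψ : Form p, (∀ w, IsInvariant a₀ P (coeff ψ w)) → (∀ w, Differentiable ℝ (coeff ψ w)) →
      (∀ (j : Fin 3) (K : Fin p → Fin 3) (x : E), dbarFun (coeff ψ fun l => hol (K l)) j x =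
        ∑ m, structTerm j (K m) fun b => coeff ψ (fun l => hol (Function.update K m b l)) x) →
      ∃ c, ∀ (K : Fin p → Fin 3) x, coeff ψ (fun l => hol (K l)) x =
        c * Matrix.det (Matrix.of fun b a => if I a = K b then (1 : ℂ) else 0)) :
    hodgeNumber a₀ P p 0 = 1 := by
  have hne : (⟨PhiWedge I, hmem⟩ : harmonic a₀ P p 0) ≠ 0 := by
    intro h0
    have h1 : (PhiWedge I : Form p) = 0 := congrArg Subtype.val h0
    have h2 := coeff_PhiWedge_hol I I 0
    have h3 : (Matrix.of fun b a => if I a = I b then (1 : ℂ) else 0) = 1 := by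
      ext b a
      simp [Matrix.one_apply, hI.eq_iff, eq_comm]
    rw [h1, h3, Matrix.det_one] at h2
    exact zero_ne_one h2
  refine (finrank_eq_one_iff_of_nonzero' (K := ℂ)
    (⟨PhiWedge I, hmem⟩ : harmonic a₀ P p 0) hne).2 ?_
  rintro ⟨ψ, hψ⟩
  obtain ⟨hA, h0⟩ := (mem_harmonic_iff hcov).1 hψ
  have hJ := isTypeTop_of_mem hA
  obtain ⟨c, hc⟩ := h ψ (isInvariant_coeff hA) (differentiable_coeff hA.1)
    (dbarFun_coeff_hol (p := p) hJ h0)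
  refine ⟨c, Subtype.ext ?_⟩
  refine eq_of_coeff_hol_eq (p := p) (ψ := c • PhiWedge I) (φ := ψ) (fun x l v => ?_) hJ
    fun K x => ?_
  · change c * PhiWedge I x _ = Complex.I * (c * PhiWedge I x v)
    rw [isTypeTop_PhiWedge]
    ring
  · rw [coeff_smul, coeff_PhiWedge_hol, hc]

/-- In code indices, f 1 is constant and W_1 f 0 = -f 1 kills it; then f 2 is constant and W_2 f 0 =
-f 2 kills it; finally f 0 is constant. -/
theorem hodgeNumber_one_zero
    (hcov : ∀ x, ∃ g ∈ lattice a₀ P, ∃ d ∈ fundDomain a₀ P, leftMul g d = x) :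
    hodgeNumber a₀ P 1 0 = 1 := by
  refine hodgeNumber_eq_one hcov (Function.injective_of_subsingleton _)
    (PhiWedge_mem_harmonic hcov).1 ?_
  intro ψ hinv hdiff heq
  set f : Fin 3 → E → ℂ := fun a => coeff ψ fun l => hol (![a] l) with hf
  have hK : ∀ K : Fin 1 → Fin 3, K = ![K 0] := fun K => by
    funext i
    fin_cases i
    rfl
  have heq' : ∀ j a x, dbarFun (f a) j x = structTerm j a fun b => f b x := by
    intro j a x
    rw [hf, heq j ![a] x, Fin.sum_univ_one]
    congr 1
    funext b
    rw [hK (Function.update _ _ b)]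
    simp
  obtain ⟨c₁, hc₁⟩ := exists_eq_const hcov (hinv _) (hdiff _) (f := f 1) fun j x => by
    rw [heq']
    simp [structTerm]
  have hc₁0 : -c₁ = 0 := eq_zero_of_dbarFun_const hcov (hinv _) (hdiff _) (f := f 0) (j := 1)
    fun x => by
      rw [heq', ← hc₁ x]
      simp [structTerm]
  rw [neg_eq_zero] at hc₁0
  subst hc₁0
  obtain ⟨c₂, hc₂⟩ := exists_eq_const hcov (hinv _) (hdiff _) (f := f 2) fun j x => by
    rw [heq']
    simp [structTerm, hc₁]
  have hc₂0 : -c₂ = 0 := eq_zero_of_dbarFun_const hcov (hinv _) (hdiff _) (f := f 0) (j := 2)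
    fun x => by
      rw [heq', ← hc₂ x]
      simp [structTerm]
  rw [neg_eq_zero] at hc₂0
  subst hc₂0
  obtain ⟨c, hc⟩ := exists_eq_const hcov (hinv _) (hdiff _) (f := f 0) fun j x => by
    rw [heq']
    simp [structTerm, hc₁, hc₂]
  refine ⟨c, fun K x => ?_⟩
  rw [hK K]
  change f (K 0) x = _
  generalize K 0 = a
  fin_cases a <;> simp [hc, hc₁, hc₂]

/-- In code indices, f 1 2 is constant and W_2 f 0 1 = f 1 2 kills it; then f 0 1 is constant and
W_0 f 0 2 = i f 0 1 kills it; finally f 0 2 is constant. -/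
theorem hodgeNumber_two_zero
    (hcov : ∀ x, ∃ g ∈ lattice a₀ P, ∃ d ∈ fundDomain a₀ P, leftMul g d = x) :
    hodgeNumber a₀ P 2 0 = 1 := by
  refine hodgeNumber_eq_one hcov (by decide) (PhiWedge_mem_harmonic hcov).2.1 ?_
  intro ψ hinv hdiff heq
  set f : Fin 3 → Fin 3 → E → ℂ := fun a b => coeff ψ fun l => hol (![a, b] l) with hf
  have hK : ∀ K : Fin 2 → Fin 3, K = ![K 0, K 1] := fun K => by
    funext i
    fin_cases i <;> rfl
  have hdiag : ∀ a x, f a a x = 0 := fun a x =>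
    coeff_hol_eq_zero ψ (K := ![a, a]) (i := 0) (j := 1) rfl (by decide) x
  have hswap : ∀ a b x, f b a x = -f a b x := by
    intro a b x
    simp only [hf]
    rw [← coeff_hol_swap ψ ![a, b] (i := 0) (j := 1) (by decide)]
    congr 1
    funext l
    fin_cases l <;> simp
  have heq' : ∀ j a b x, dbarFun (f a b) j x =
      (structTerm j a fun c => f c b x) + structTerm j b fun c => f a c x := by
    intro j a b x
    rw [hf, heq j ![a, b] x, Fin.sum_univ_two]
    congr 2 <;> funext c <;> rw [hK (Function.update _ _ c)] <;> simp
  obtain ⟨c₁, hc₁⟩ := exists_eq_const hcov (hinv _) (hdiff _) (f := f 1 2) fun j x => by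
    rw [heq']
    simp [structTerm, hdiag]
  have hc₁0 : c₁ = 0 := eq_zero_of_dbarFun_const hcov (hinv _) (hdiff _) (f := f 0 1) (j := 2)
    fun x => by
      rw [heq', ← hc₁ x]
      simp [structTerm, hswap 1 2]
  subst hc₁0
  obtain ⟨c₂, hc₂⟩ := exists_eq_const hcov (hinv _) (hdiff _) (f := f 0 1) fun j x => by
    rw [heq']
    simp [structTerm, hdiag, hswap 1 2, hc₁]
  have hc₂0 : Complex.I * c₂ = 0 := eq_zero_of_dbarFun_const hcov (hinv _) (hdiff _)
    (f := f 0 2) (j := 0) fun x => by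
      rw [heq', ← hc₂ x]
      simp [structTerm]
  replace hc₂0 : c₂ = 0 := by simpa using hc₂0
  subst hc₂0
  obtain ⟨c, hc⟩ := exists_eq_const hcov (hinv _) (hdiff _) (f := f 0 2) fun j x => by
    rw [heq']
    simp [structTerm, hdiag, hc₁, hc₂]
  refine ⟨c, fun K x => ?_⟩
  rw [hK K]
  change f (K 0) (K 1) x = _
  generalize K 0 = a
  generalize K 1 = b
  fin_cases a <;> fin_cases b <;>
    simp [Matrix.det_fin_two, hc, hc₁, hc₂, hdiag, hswap 0 1, hswap 0 2, hswap 1 2]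

/-- Every structure term replaces an index by one already present, so by antisymmetry the single
coefficient satisfies W_j f = 0 for all j. -/
theorem hodgeNumber_three_zero
    (hcov : ∀ x, ∃ g ∈ lattice a₀ P, ∃ d ∈ fundDomain a₀ P, leftMul g d = x) :
    hodgeNumber a₀ P 3 0 = 1 := by
  refine hodgeNumber_eq_one hcov (by decide) (PhiWedge_mem_harmonic hcov).2.2 ?_
  intro ψ hinv hdiff heq
  set f : Fin 3 → Fin 3 → Fin 3 → E → ℂ := fun a b c => coeff ψ fun l => hol (![a, b, c] l) with hf
  have hK : ∀ K : Fin 3 → Fin 3, K = ![K 0, K 1, K 2] := fun K => by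
    funext i
    fin_cases i <;> rfl
  have h01 : ∀ a b x, f a a b x = 0 := fun a b x =>
    coeff_hol_eq_zero ψ (K := ![a, a, b]) (i := 0) (j := 1) rfl (by decide) x
  have h12 : ∀ a b x, f b a a x = 0 := fun a b x =>
    coeff_hol_eq_zero ψ (K := ![b, a, a]) (i := 1) (j := 2) rfl (by decide) x
  have h02 : ∀ a b x, f a b a x = 0 := fun a b x =>
    coeff_hol_eq_zero ψ (K := ![a, b, a]) (i := 0) (j := 2) rfl (by decide) x
  have s01 : ∀ a b c x, f b a c x = -f a b c x := by
    intro a b c x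
    simp only [hf]
    rw [← coeff_hol_swap ψ ![a, b, c] (i := 0) (j := 1) (by decide)]
    congr 1
    funext l
    fin_cases l <;> rfl
  have s12 : ∀ a b c x, f a c b x = -f a b c x := by
    intro a b c x
    simp only [hf]
    rw [← coeff_hol_swap ψ ![a, b, c] (i := 1) (j := 2) (by decide)]
    congr 1
    funext l
    fin_cases l <;> rfl
  have heq' : ∀ j a b c x, dbarFun (f a b c) j x =
      (structTerm j a fun d => f d b c x) + (structTerm j b fun d => f a d c x) +
        structTerm j c fun d => f a b d x := by
    intro j a b c x
    rw [hf, heq j ![a, b, c] x, Fin.sum_univ_three]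
    congr 3 <;> funext d <;> rw [hK (Function.update _ _ d)] <;> simp
  obtain ⟨c, hc⟩ := exists_eq_const hcov (hinv _) (hdiff _) (f := f 0 1 2) fun j x => by
    rw [heq']
    simp [structTerm, h01, h02, h12]
  have e1 : ∀ x, f 0 2 1 x = -c := fun x => by rw [s12, hc]
  have e2 : ∀ x, f 1 0 2 x = -c := fun x => by rw [s01, hc]
  have e3 : ∀ x, f 1 2 0 x = c := fun x => by rw [s12, e2, neg_neg]
  have e4 : ∀ x, f 2 0 1 x = c := fun x => by rw [s01, e1, neg_neg]
  have e5 : ∀ x, f 2 1 0 x = -c := fun x => by rw [s12, e4]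
  refine ⟨c, fun K x => ?_⟩
  rw [hK K]
  change f (K 0) (K 1) (K 2) x = _
  generalize K 0 = a
  generalize K 1 = b
  generalize K 2 = d
  fin_cases a <;> fin_cases b <;> fin_cases d <;>
    simp [Matrix.det_fin_three, hc, e1, e2, e3, e4, e5, h01, h02, h12]

end Harmonic

end Solvmanifold

end

theorem mainTheorem7 (B : Matrix.SpecialLinearGroup (Fin 2) ℤ) (a₀ : ℝ) (ha₀ : a₀ ≠ 0)
    (P : Matrix (Fin 2) (Fin 2) ℝ) (hP : IsUnit P.det)
    (hB : P * (B : Matrix (Fin 2) (Fin 2) ℤ).map (Int.cast : ℤ → ℝ) * P⁻¹ =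
      Matrix.diagonal ![Real.exp a₀, Real.exp (-a₀)]) :
    Solvmanifold.hodgeNumber a₀ P 1 0 = 1 ∧
      Solvmanifold.hodgeNumber a₀ P 2 0 = 1 ∧
      Solvmanifold.hodgeNumber a₀ P 3 0 = 1 := by
  have hcov := Solvmanifold.exists_leftMul_eq ha₀ hP hB
  exact ⟨Solvmanifold.hodgeNumber_one_zero hcov, Solvmanifold.hodgeNumber_two_zero hcov,
    Solvmanifold.hodgeNumber_three_zero hcov⟩
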